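/- Let $\mathcal A$ be an operator algebra, i.e. a norm-closed (not necessarily unital or selfadjoint) subalgebra of $B(H)$ for a Hilbert space $H$, let $G$ be a discrete abelian group, and let $\alpha$ be a homomorphism from $G$ to the group of completely isometric automorphisms of $\mathcal A$. Let $\mathrm{C}^*_{\max}(\mathcal A)$ be the maximal (universal) $\mathrm{C}^*$-algebra of $\mathcal A$, that is, the $\mathrm{C}^*$-algebra generated by the image of $\mathcal A$ under the direct sum $j$ of its completely contractive representations on Hilbert spaces. The action $\alpha$ extends uniquely to an action of $G$ on $\mathrm{C}^*_{\max}(\mathcal A)$ by $*$-automorphisms, again denoted by $\alpha$. The crossed product $\mathcal A\rtimes_\alpha G$ is the closed subalgebra, generated by $C_c(G,j(\mathcal A))$, of the full crossed product $\mathrm{C}^*$-algebra $\mathrm{C}^*_{\max}(\mathcal A)\rtimes_\alpha G$. A (not necessarily unital) ring $R$ is called semisimple if its Jacobson radical, the intersection of all maximal regular right ideals of $R$, is $\{0\}$; here a right ideal $I$ is regular if there is $e\in R$ with $ex-x\in I$ for all $x\in R$. If $\mathcal A$ is semisimple, then $\mathcal A\rtimes_\alpha G$ is semisimple. -/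

import Mathlib

open scoped ENNReal

noncomputable section

namespace OpAlg

universe u v w

/-! ### The Jacobson radical of a ring that need not have a unit -/

section Radical

variable {R : Type*} [NonUnitalRing R]

/-- A right ideal of a (not necessarily unital) ring: an additive subgroup that absorbs
multiplication from the right. -/
def IsRightIdeal (I : AddSubgroup R) : Prop :=
  ∀ x ∈ I, ∀ r : R, x * r ∈ I

/-- A right ideal is regular if there is `e` such that `e * x - x ∈ I` for all `x`. -/
def IsRegularRightIdeal (I : AddSubgroup R) : Prop :=
  IsRightIdeal I ∧ ∃ e : R, ∀ x : R, e * x - x ∈ I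

/-- A maximal regular right ideal: a proper regular right ideal that is contained in no other
proper right ideal. -/
def IsMaximalRegularRightIdeal (I : AddSubgroup R) : Prop :=
  IsRegularRightIdeal I ∧ I ≠ ⊤ ∧
    ∀ J : AddSubgroup R, IsRightIdeal J → I ≤ J → J ≠ ⊤ → J = I

variable (R) in
/-- The Jacobson radical: the intersection of all maximal regular right ideals (the whole ring if
there are none). -/
def jacobsonRadical : Set R :=
  {x | ∀ I : AddSubgroup R, IsMaximalRegularRightIdeal I → x ∈ I}

variable (R) in
/-- A ring is semisimple if its Jacobson radical is zero. -/
def IsSemisimple : Prop :=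
  jacobsonRadical R = {0}

end Radical

/-! ### Completely contractive homomorphisms of operator algebras

An operator algebra is a norm closed subalgebra `A` of `B(H)`; closedness is a hypothesis of
the theorem, the definitions below do not need it. The norm of an `n × n` matrix over `B(H)` is
its norm in the C⋆-algebra `M_n(B(H))`. -/

section CompletelyContractive

variable {H : Type*} [NormedAddCommGroup H] [InnerProductSpace ℂ H] [CompleteSpace H]
variable {K : Type*} [NormedAddCommGroup K] [InnerProductSpace ℂ K] [CompleteSpace K]

/-- A homomorphism `π : A → B(K)` is completely contractive if all its amplifications
`M_n(A) → M_n(B(K))` are contractive. -/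
def IsCompletelyContractive {A : NonUnitalSubalgebra ℂ (H →L[ℂ] H)}
    (π : A →ₙₐ[ℂ] (K →L[ℂ] K)) : Prop :=
  ∀ (n : ℕ) (M : Matrix (Fin n) (Fin n) A),
    ‖CStarMatrix.ofMatrix (M.map fun a => π a)‖ ≤
      ‖CStarMatrix.ofMatrix (M.map fun a => (a : H →L[ℂ] H))‖

/-- A homomorphism `π : A → B(K)` is completely isometric if all its amplifications
`M_n(A) → M_n(B(K))` are isometric. -/
def IsCompletelyIsometric {A : NonUnitalSubalgebra ℂ (H →L[ℂ] H)}
    (π : A →ₙₐ[ℂ] (K →L[ℂ] K)) : Prop :=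
  ∀ (n : ℕ) (M : Matrix (Fin n) (Fin n) A),
    ‖CStarMatrix.ofMatrix (M.map fun a => π a)‖ =
      ‖CStarMatrix.ofMatrix (M.map fun a => (a : H →L[ℂ] H))‖

theorem norm_toOneByOne (T : H →L[ℂ] H) :
    ‖CStarMatrix.ofMatrix (fun _ _ : Fin 1 => T)‖ = ‖T‖ := by
  have h := NonUnitalStarAlgHom.norm_map
    (CStarMatrix.toOneByOne (Fin 1) ℂ (H →L[ℂ] H)).toNonUnitalStarAlgHom
    (CStarMatrix.toOneByOne (Fin 1) ℂ (H →L[ℂ] H)).injective T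
  exact h

theorem IsCompletelyContractive.norm_le {A : NonUnitalSubalgebra ℂ (H →L[ℂ] H)}
    {π : A →ₙₐ[ℂ] (K →L[ℂ] K)} (hπ : IsCompletelyContractive π) (a : A) :
    ‖π a‖ ≤ ‖(a : H →L[ℂ] H)‖ := by
  have h := hπ 1 (fun _ _ => a)
  rw [← norm_toOneByOne (π a), ← norm_toOneByOne (a : H →L[ℂ] H)]
  exact h

end CompletelyContractive

/-! ### Dynamical systems -/

/-- An action of a (discrete) group `G` on an operator algebra `A` by completely isometric
automorphisms, that is, a homomorphism from `G` to the group of completely isometric automorphisms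
of `A`. (Each `α s` is bijective, with inverse `α s⁻¹`.) -/
structure Action (G : Type v) [Group G] {H : Type u} [NormedAddCommGroup H]
    [InnerProductSpace ℂ H] [CompleteSpace H] (A : NonUnitalSubalgebra ℂ (H →L[ℂ] H)) where
  /-- The automorphism `α s`. -/
  toHom : G → A →ₙₐ[ℂ] A
  map_one : ∀ a : A, toHom 1 a = a
  map_mul : ∀ (s t : G) (a : A), toHom (s * t) a = toHom s (toHom t a)
  completelyIsometric : ∀ s : G,
    IsCompletelyIsometric ((NonUnitalSubalgebraClass.subtype A).comp (toHom s))

/-! ### The maximal C⋆-algebra of an operator algebra -/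

section CStarMax

variable {H : Type u} [NormedAddCommGroup H] [InnerProductSpace ℂ H] [CompleteSpace H]
variable (A : NonUnitalSubalgebra ℂ (H →L[ℂ] H))

/-- A completely contractive representation of `A` on a Hilbert space. -/
structure CCRep : Type (u + 1) where
  /-- The Hilbert space. -/
  K : Type u
  [normed : NormedAddCommGroup K]
  [inner : InnerProductSpace ℂ K]
  [complete : CompleteSpace K]
  /-- The representation. -/
  π : A →ₙₐ[ℂ] (K →L[ℂ] K)
  completelyContractive : IsCompletelyContractive π

attribute [instance] CCRep.normed CCRep.inner CCRep.complete

/-- The C⋆-algebra of bounded families of operators, indexed by all completely contractive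
representations of `A`. -/
def CCProd : Type (u + 1) := lp (fun r : CCRep A => r.K →L[ℂ] r.K) ∞

instance CCProd.instNonUnitalCStarAlgebra : NonUnitalCStarAlgebra (CCProd A) :=
  inferInstanceAs (NonUnitalCStarAlgebra (lp (fun r : CCRep A => r.K →L[ℂ] r.K) ∞))

variable {A}

/-- The entry at `r` of a bounded family. -/
def CCProd.entry (x : CCProd A) (r : CCRep A) : r.K →L[ℂ] r.K := x.1 r

theorem CCProd.ext {x y : CCProd A} (h : ∀ r, x.entry r = y.entry r) : x = y :=
  lp.ext (funext h)

theorem CCProd.norm_entry_le (x : CCProd A) (r : CCRep A) : ‖x.entry r‖ ≤ ‖x‖ :=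
  lp.norm_apply_le_norm (E := fun r : CCRep A => r.K →L[ℂ] r.K) ENNReal.top_ne_zero x r

/-- The element of the product with the given uniformly bounded entries. -/
def CCProd.mk (f : ∀ r : CCRep A, r.K →L[ℂ] r.K) (b : ℝ) (hb : ∀ r, ‖f r‖ ≤ b) : CCProd A :=
  ⟨f, memℓp_infty ⟨b, by rintro _ ⟨r, rfl⟩; exact hb r⟩⟩

/-- The family `(π(a))_π` over all completely contractive representations `π`. -/
def toCCProd (a : A) : CCProd A :=
  CCProd.mk (fun r => r.π a) ‖(a : H →L[ℂ] H)‖ fun r => r.completelyContractive.norm_le a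

variable (A)

/-- The C⋆-subalgebra of the product that is generated by the families `(π(a))_π`. -/
def cstarMaxSubalgebra : NonUnitalStarSubalgebra ℂ (CCProd A) :=
  (NonUnitalStarAlgebra.adjoin ℂ (Set.range (toCCProd (A := A)))).topologicalClosure

instance cstarMaxSubalgebra.isClosed : IsClosed (cstarMaxSubalgebra A : Set (CCProd A)) :=
  NonUnitalStarSubalgebra.isClosed_topologicalClosure _

/-- The maximal (universal) C⋆-algebra `C*_max(A)`: the C⋆-algebra generated by the image of `A`
under the direct sum of all its completely contractive representations. -/
def CStarMax : Type (u + 1) := cstarMaxSubalgebra A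

instance CStarMax.instNonUnitalCStarAlgebra : NonUnitalCStarAlgebra (CStarMax A) :=
  inferInstanceAs (NonUnitalCStarAlgebra (cstarMaxSubalgebra A))

variable {A}

theorem toCCProd_mem (a : A) : toCCProd a ∈ cstarMaxSubalgebra A :=
  NonUnitalStarSubalgebra.le_topologicalClosure _
    (NonUnitalStarAlgebra.subset_adjoin ℂ _ ⟨a, rfl⟩)

variable (A)

/-- The canonical homomorphism `j : A → C*_max(A)`. -/
def CStarMax.j : A →ₙₐ[ℂ] CStarMax A where
  toFun a := ⟨toCCProd a, toCCProd_mem a⟩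
  map_smul' c a := Subtype.ext <| CCProd.ext fun r => map_smul r.π c a
  map_zero' := Subtype.ext <| CCProd.ext fun r => map_zero r.π
  map_add' a b := Subtype.ext <| CCProd.ext fun r => map_add r.π a b
  map_mul' a b := Subtype.ext <| CCProd.ext fun r => map_mul r.π a b

variable {A}

/-- The representation `π ∘ α_s`. -/
def CCRep.twist {G : Type v} [Group G] (α : Action G A) (s : G) (r : CCRep A) : CCRep A where
  K := r.K
  π := r.π.comp (α.toHom s)
  completelyContractive n M :=
    (r.completelyContractive n (M.map (α.toHom s))).trans (α.completelyIsometric s n M).le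

/-- The ⋆-endomorphism `(x_π)_π ↦ (x_{π ∘ α_s})_π` of the product algebra. -/
def CCProd.shift {G : Type v} [Group G] (α : Action G A) (s : G) :
    CCProd A →⋆ₙₐ[ℂ] CCProd A where
  toFun x := CCProd.mk (fun r => x.entry (r.twist α s)) ‖x‖ fun r =>
    x.norm_entry_le (r.twist α s)
  map_smul' _ _ := rfl
  map_zero' := rfl
  map_add' _ _ := rfl
  map_mul' _ _ := rfl
  map_star' _ := rfl

theorem CCProd.entry_congr (x : CCProd A) {K : Type u} [NormedAddCommGroup K]
    [InnerProductSpace ℂ K] [CompleteSpace K] {π π' : A →ₙₐ[ℂ] (K →L[ℂ] K)}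
    (h : π = π') (hπ : IsCompletelyContractive π) (hπ' : IsCompletelyContractive π') :
    x.entry ⟨K, π, hπ⟩ = x.entry ⟨K, π', hπ'⟩ := by
  subst h
  rfl

theorem CCProd.shift_one {G : Type v} [Group G] (α : Action G A) (x : CCProd A) :
    CCProd.shift α 1 x = x := by
  refine CCProd.ext fun r => ?_
  have h : r.π.comp (α.toHom 1) = r.π :=
    NonUnitalAlgHom.ext fun a => congrArg (fun b => r.π b) (α.map_one a)
  exact CCProd.entry_congr x h _ _

theorem CCProd.shift_mul {G : Type v} [Group G] (α : Action G A) (s t : G) (x : CCProd A) :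
    CCProd.shift α (s * t) x = CCProd.shift α s (CCProd.shift α t x) := by
  refine CCProd.ext fun r => ?_
  have h : r.π.comp (α.toHom (s * t)) = (r.π.comp (α.toHom s)).comp (α.toHom t) :=
    NonUnitalAlgHom.ext fun a => congrArg (fun b => r.π b) (α.map_mul s t a)
  exact CCProd.entry_congr x h _ _

theorem CCProd.shift_continuous {G : Type v} [Group G] (α : Action G A) (s : G) :
    Continuous (CCProd.shift α s) :=
  AddMonoidHomClass.continuous_of_bound (CCProd.shift α s) 1 fun x => by
    rw [one_mul]
    exact NonUnitalStarAlgHom.norm_apply_le (CCProd.shift α s) x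

theorem CCProd.shift_mem {G : Type v} [Group G] (α : Action G A) (s : G) {x : CCProd A}
    (hx : x ∈ cstarMaxSubalgebra A) : CCProd.shift α s x ∈ cstarMaxSubalgebra A := by
  have h : cstarMaxSubalgebra A ≤ (cstarMaxSubalgebra A).comap (CCProd.shift α s) := by
    refine NonUnitalStarSubalgebra.topologicalClosure_minimal _
      (NonUnitalStarAlgebra.adjoin_le ?_)
      ((cstarMaxSubalgebra.isClosed A).preimage (CCProd.shift_continuous α s))
    rintro _ ⟨a, rfl⟩
    exact toCCProd_mem (α.toHom s a)
  exact h hx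

/-- The ⋆-automorphism of `C*_max(A)` that extends `j ∘ α_s ∘ j⁻¹`. -/
def CStarMax.extend {G : Type v} [Group G] (α : Action G A) (s : G) :
    CStarMax A ≃⋆ₐ[ℂ] CStarMax A where
  toFun x := ⟨CCProd.shift α s x.1, CCProd.shift_mem α s x.2⟩
  invFun x := ⟨CCProd.shift α s⁻¹ x.1, CCProd.shift_mem α s⁻¹ x.2⟩
  left_inv x := Subtype.ext <| by
    change CCProd.shift α s⁻¹ (CCProd.shift α s x.1) = x.1
    rw [← CCProd.shift_mul, inv_mul_cancel, CCProd.shift_one]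
  right_inv x := Subtype.ext <| by
    change CCProd.shift α s (CCProd.shift α s⁻¹ x.1) = x.1
    rw [← CCProd.shift_mul, mul_inv_cancel, CCProd.shift_one]
  map_mul' _ _ := rfl
  map_add' _ _ := rfl
  map_star' _ := rfl
  map_smul' _ _ := rfl

/-- The action of `G` on `C*_max(A)` by ⋆-automorphisms that extends `α`. -/
def CStarMax.action {G : Type v} [Group G] (α : Action G A) :
    G →* (CStarMax A ≃⋆ₐ[ℂ] CStarMax A) where
  toFun := CStarMax.extend α
  map_one' := StarAlgEquiv.ext fun x => Subtype.ext (CCProd.shift_one α x.1)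
  map_mul' s t := StarAlgEquiv.ext fun x => Subtype.ext (CCProd.shift_mul α s t x.1)

theorem CStarMax.action_j {G : Type v} [Group G] (α : Action G A) (s : G) (a : A) :
    CStarMax.action α s (CStarMax.j A a) = CStarMax.j A (α.toHom s a) := rfl

end CStarMax

/-! ### The full crossed product of a C⋆-algebra by a discrete group -/

section CrossedProduct

variable {C : Type w} [NonUnitalCStarAlgebra C] {G : Type v} [Group G]

/-- A covariant representation `(π, U)` of a C⋆-dynamical system `(C, G, β)` with `G` discrete:
a ⋆-representation `π` of `C` and a unitary representation `U` of `G` on the same Hilbert space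
with `π(β_s(c)) = U_s π(c) U_s⋆`. -/
structure CovariantRep (β : G →* (C ≃⋆ₐ[ℂ] C)) : Type (max w v + 1) where
  /-- The Hilbert space. -/
  K : Type (max w v)
  [normed : NormedAddCommGroup K]
  [inner : InnerProductSpace ℂ K]
  [complete : CompleteSpace K]
  /-- The representation of `C`. -/
  π : C →⋆ₙₐ[ℂ] (K →L[ℂ] K)
  /-- The unitary representation of `G`. -/
  U : G →* unitary (K →L[ℂ] K)
  covariant : ∀ (s : G) (c : C),
    π (β s c) = (U s : K →L[ℂ] K) * π c * star (U s : K →L[ℂ] K)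

attribute [instance] CovariantRep.normed CovariantRep.inner CovariantRep.complete

variable (β : G →* (C ≃⋆ₐ[ℂ] C))

/-- The C⋆-algebra of bounded families of operators, indexed by all covariant representations. -/
def CovProd : Type (max w v + 1) := lp (fun r : CovariantRep β => r.K →L[ℂ] r.K) ∞

instance CovProd.instNonUnitalCStarAlgebra : NonUnitalCStarAlgebra (CovProd β) :=
  inferInstanceAs (NonUnitalCStarAlgebra (lp (fun r : CovariantRep β => r.K →L[ℂ] r.K) ∞))

theorem CovariantRep.norm_monomial_le {β : G →* (C ≃⋆ₐ[ℂ] C)} (r : CovariantRep β) (c : C)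
    (s : G) : ‖r.π c * (r.U s : r.K →L[ℂ] r.K)‖ ≤ ‖c‖ := by
  rw [CStarRing.norm_mul_coe_unitary (r.π c) (r.U s)]
  exact NonUnitalStarAlgHom.norm_apply_le r.π c

/-- The family `(π(c) U_s)` over all covariant representations `(π, U)`. -/
def covMonomial (c : C) (s : G) : CovProd β :=
  ⟨fun r => r.π c * (r.U s : r.K →L[ℂ] r.K), memℓp_infty ⟨‖c‖, by
    rintro _ ⟨r, rfl⟩
    exact r.norm_monomial_le c s⟩⟩

/-- The family of integrated forms `∑_s π(f(s)) U_s`, over all covariant representations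
`(π, U)`, of a function `f` in `C_c(G, C)`, that is, of a finitely supported function. -/
def integratedForm (f : G →₀ C) : CovProd β :=
  f.sum fun s c => covMonomial β c s

/-- The C⋆-subalgebra of the product that is generated by the integrated forms of the functions in
`C_c(G, C)`. -/
def cstarCrossedProductSubalgebra : NonUnitalStarSubalgebra ℂ (CovProd β) :=
  (NonUnitalStarAlgebra.adjoin ℂ (Set.range (integratedForm β))).topologicalClosure

instance cstarCrossedProductSubalgebra.isClosed :
    IsClosed (cstarCrossedProductSubalgebra β : Set (CovProd β)) :=
  NonUnitalStarSubalgebra.isClosed_topologicalClosure _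

/-- The full crossed product `C ⋊_β G`: the C⋆-algebra generated by the image of `C_c(G, C)` under
the direct sum of the integrated forms of all covariant representations. -/
def CStarCrossedProduct : Type (max w v + 1) := cstarCrossedProductSubalgebra β

instance CStarCrossedProduct.instNonUnitalCStarAlgebra :
    NonUnitalCStarAlgebra (CStarCrossedProduct β) :=
  inferInstanceAs (NonUnitalCStarAlgebra (cstarCrossedProductSubalgebra β))

/-- The canonical map `C_c(G, C) → C ⋊_β G`. -/
def CStarCrossedProduct.of (f : G →₀ C) : CStarCrossedProduct β :=
  ⟨integratedForm β f, NonUnitalStarSubalgebra.le_topologicalClosure _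
    (NonUnitalStarAlgebra.subset_adjoin ℂ _ ⟨f, rfl⟩)⟩

/-- The closed subalgebra of `C ⋊_β G` generated by `C_c(G, B)`, for a subset `B` of `C`. -/
def relativeCrossedProduct (B : Set C) : NonUnitalSubalgebra ℂ (CStarCrossedProduct β) :=
  (NonUnitalAlgebra.adjoin ℂ
    {x | ∃ f : G →₀ C, (∀ s, f s ∈ B) ∧ CStarCrossedProduct.of β f = x}).topologicalClosure

end CrossedProduct

/-! ### The crossed product of an operator algebra by a discrete group -/

/-- The full crossed product `A ⋊_α G`: the closed subalgebra of `C*_max(A) ⋊_α G` generated by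
`C_c(G, j(A))`. -/
def crossedProduct {G : Type v} [Group G] {H : Type u} [NormedAddCommGroup H]
    [InnerProductSpace ℂ H] [CompleteSpace H] {A : NonUnitalSubalgebra ℂ (H →L[ℂ] H)}
    (α : Action G A) : NonUnitalSubalgebra ℂ (CStarCrossedProduct (CStarMax.action α)) :=
  relativeCrossedProduct (CStarMax.action α) (Set.range (CStarMax.j A))

end OpAlg

end

namespace OpAlg

universe u v w

/-! ### Maximal regular right ideals -/

section Ideals

variable {R : Type*} [NonUnitalRing R] {I : AddSubgroup R}

/-! Write `B` for the crossed product and `a U_s` for its monomials. The characters `χ` of `G` act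
on `B` by automorphisms `θ_χ` with `θ_χ(a U_s) = χ(s) a U_s`. The Jacobson radical of the Banach
algebra `B` is a closed linear subspace that every automorphism preserves. With `x` it therefore
contains each Fourier coefficient `∫ χ(s)⁻¹ θ_χ(x) dχ`, taken over the compact dual group, and this
coefficient is itself a monomial `a U_s`. Two facts finish the proof.

A monomial `a U_s` in the radical of `B` is zero. Multiplying it by `c U_{s⁻¹}` puts `a α_s(c)` into
the radical of `B`, for every `c` in `A`. Elements of the radical have spectral radius zero, and by
Gelfand's formula the spectral radius is the same in `A` and in `B`, because `A` sits isometrically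
in `B`. Hence an element of `A` that is radical in `B` is radical in `A`
(`mem_jacobsonRadical_of_isometric`). So `a b` is in the radical of `A` for all `b`, then so is `a`,
and `a = 0`.

An `x` whose Fourier coefficients all vanish is zero, because the evaluations at group elements span
a dense subspace of the continuous functions on the dual group
(`eq_zero_of_integral_dualEval_smul_eq_zero`).

`jacobsonRadical_eq_of_dual_action` carries out this argument for an abstract `B`. What remains is
to check its hypotheses; the isometry of `a ↦ a U_s` comes from the regular representation
(`norm_le_norm_regularRep_j`). -/

theorem IsMaximalRegularRightIdeal.mem_of_forall_mul_mem (hI : IsMaximalRegularRightIdeal I)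
    {x : R} (hx : ∀ b, x * b ∈ I) : x ∈ I := by
  obtain ⟨⟨hr, e, he⟩, hne, hmax⟩ := hI
  -- `J` is a right ideal containing `I`. If it were everything, then `e * b ∈ I` and `e * b - b ∈
  -- I` would give `I = ⊤`, so maximality forces `J = I`.
  let J : AddSubgroup R :=
    { carrier := {y | ∀ b, y * b ∈ I}
      add_mem' := fun ha hb c => by rw [add_mul]; exact I.add_mem (ha c) (hb c)
      zero_mem' := fun c => by rw [zero_mul]; exact I.zero_mem
      neg_mem' := fun ha c => by rw [neg_mul]; exact I.neg_mem (ha c) }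
  have hJ : J = I := by
    refine hmax J (fun y hy r b => ?_) (fun y hy b => hr y hy b) fun htop => hne ?_
    · rw [mul_assoc]; exact hy _
    · refine (AddSubgroup.eq_top_iff' _).2 fun b => ?_
      have h : e ∈ J := htop ▸ AddSubgroup.mem_top e
      simpa using I.sub_mem (h b) (he b)
  rw [← hJ]
  exact hx

/-- Ideals are only additive subgroups here, so linearity needs an argument: `(c • x) * b = x * (c •
b)` lies in `I` for every `b`. -/
theorem IsMaximalRegularRightIdeal.smul_mem {𝕜 : Type*} [CommRing 𝕜] [Module 𝕜 R]
    [IsScalarTower 𝕜 R R] [SMulCommClass 𝕜 R R] (hI : IsMaximalRegularRightIdeal I) (c : 𝕜)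
    {x : R} (hx : x ∈ I) : c • x ∈ I :=
  hI.mem_of_forall_mul_mem fun b => by
    rw [smul_mul_assoc, ← mul_smul_comm]
    exact hI.1.1 x hx _

theorem eq_top_of_mem_of_isRightIdeal (hI : IsRightIdeal I) {e : R} (he : ∀ x, e * x - x ∈ I)
    (heI : e ∈ I) : I = ⊤ :=
  (AddSubgroup.eq_top_iff' _).2 fun b => by
    simpa using I.sub_mem (hI e heI b) (he b)

/-- Zorn's lemma for the right ideals that omit `e`: above `I`, omitting `e` is the same as being
proper. -/
theorem exists_isMaximalRegularRightIdeal_le (hI : IsRightIdeal I) {e : R}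
    (he : ∀ x, e * x - x ∈ I) (heI : e ∉ I) :
    ∃ J, IsMaximalRegularRightIdeal J ∧ I ≤ J ∧ e ∉ J := by
  obtain ⟨J, hIJ, hJ⟩ := zorn_le_nonempty₀ {J : AddSubgroup R | IsRightIdeal J ∧ e ∉ J}
    (fun c hc hchain y hy => by
      have hmem : ∀ {x : R}, x ∈ sSup c ↔ ∃ s ∈ c, x ∈ s :=
        AddSubgroup.mem_sSup_of_directedOn ⟨y, hy⟩ hchain.directedOn
      refine ⟨sSup c, ⟨fun x hx r => ?_, fun h => ?_⟩, fun z hz => le_sSup hz⟩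
      · obtain ⟨s, hs, hxs⟩ := hmem.1 hx
        exact hmem.2 ⟨s, hs, (hc hs).1 x hxs r⟩
      · obtain ⟨s, hs, hxs⟩ := hmem.1 h
        exact (hc hs).2 hxs) I ⟨hI, heI⟩
  refine ⟨J, ⟨⟨hJ.1.1, e, fun x => hIJ (he x)⟩, fun h => hJ.1.2 (h ▸ AddSubgroup.mem_top e),
    fun K hK hJK hne => ?_⟩, hIJ, hJ.1.2⟩
  refine le_antisymm (hJ.2 ⟨hK, fun h => hne ?_⟩ hJK) hJK
  exact eq_top_of_mem_of_isRightIdeal hK (fun x => hJK (hIJ (he x))) h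

variable (𝕜 R : Type*) [NonUnitalRing R] [CommRing 𝕜] [Module 𝕜 R] [IsScalarTower 𝕜 R R]
  [SMulCommClass 𝕜 R R]

/-- The Jacobson radical of an algebra, as a linear subspace. -/
def jacobsonSubmodule : Submodule 𝕜 R where
  carrier := jacobsonRadical R
  add_mem' hx hy I hI := I.add_mem (hx I hI) (hy I hI)
  zero_mem' I _ := I.zero_mem
  smul_mem' c _ hx I hI := hI.smul_mem c (hx I hI)

variable {𝕜 R}

theorem mul_mem_jacobsonRadical {x : R} (hx : x ∈ jacobsonRadical R) (y : R) :
    x * y ∈ jacobsonRadical R :=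
  fun I hI => hI.1.1 x (hx I hI) y

theorem mem_jacobsonRadical_of_forall_mul_mem {x : R} (hx : ∀ b, x * b ∈ jacobsonRadical R) :
    x ∈ jacobsonRadical R :=
  fun I hI => hI.mem_of_forall_mul_mem fun b => hx b I hI

theorem map_mem_jacobsonRadical {S F : Type*} [NonUnitalRing S] [FunLike F R S]
    [NonUnitalRingHomClass F R S] (f : F) (hf : Function.Bijective f) {x : R}
    (hx : x ∈ jacobsonRadical R) : f x ∈ jacobsonRadical S := by
  intro I hI
  obtain ⟨⟨hr, e, he⟩, hne, hmax⟩ := hI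
  have hs : Function.Surjective (AddMonoidHomClass.toAddMonoidHom f) := hf.2
  refine hx (I.comap (AddMonoidHomClass.toAddMonoidHom f)) ⟨⟨fun y hy r => ?_, ?_⟩, fun h => hne ?_,
    fun J hJ hIJ hJne => ?_⟩
  · change f (y * r) ∈ I
    rw [map_mul]
    exact hr _ hy _
  · obtain ⟨e', rfl⟩ := hf.2 e
    refine ⟨e', fun y => ?_⟩
    change f (e' * y - y) ∈ I
    rw [map_sub, map_mul]
    exact he _
  · refine (AddSubgroup.eq_top_iff' _).2 fun y => ?_
    obtain ⟨y, rfl⟩ := hf.2 y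
    exact (h ▸ AddSubgroup.mem_top y : y ∈ I.comap (AddMonoidHomClass.toAddMonoidHom f))
  · have hmap : J.map (AddMonoidHomClass.toAddMonoidHom f) = I := by
      refine hmax _ ?_ (fun y hy => ?_) fun h => hJne ?_
      · rintro _ ⟨y, hy, rfl⟩ r
        obtain ⟨r, rfl⟩ := hf.2 r
        exact ⟨y * r, hJ y hy r, map_mul f y r⟩
      · obtain ⟨y, rfl⟩ := hf.2 y
        exact ⟨y, hIJ hy, rfl⟩
      · refine (AddSubgroup.eq_top_iff' _).2 fun y => ?_
        obtain ⟨z, hz, hzy⟩ : f y ∈ J.map (AddMonoidHomClass.toAddMonoidHom f) :=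
          h ▸ AddSubgroup.mem_top _
        exact hf.1 hzy ▸ hz
    rw [← hmap, AddSubgroup.comap_map_eq_self_of_injective]
    exact hf.1

/-- The right ideal of all `x * y + y` is regular with left unit `-x` modulo it. If it omitted `-x`,
some maximal regular right ideal would omit `x`. The solution `y = -x - x * y` is again in the
radical, so the lemma can be iterated. -/
theorem exists_add_add_mul_eq_zero {x : R} (hx : x ∈ jacobsonRadical R) :
    ∃ y ∈ jacobsonRadical R, y + x + x * y = 0 := by
  let I : AddSubgroup R := (AddMonoidHom.mulLeft x + AddMonoidHom.id R).range
  have hI : IsRightIdeal I := by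
    rintro _ ⟨y, rfl⟩ r
    exact ⟨y * r, by simp [add_mul, mul_assoc]⟩
  have h : -x ∈ I := by
    by_contra h
    obtain ⟨J, hJ, -, hxJ⟩ := exists_isMaximalRegularRightIdeal_le hI
      (fun y => ⟨-y, by simp [sub_eq_add_neg]⟩) h
    exact hxJ (J.neg_mem (hx J hJ))
  obtain ⟨y, hy⟩ := h
  have hy' : x * y + y = -x := hy
  refine ⟨y, ?_, by rw [add_right_comm, add_comm y, hy', neg_add_cancel]⟩
  rw [eq_sub_of_add_eq' hy']
  exact (jacobsonSubmodule ℤ R).sub_mem ((jacobsonSubmodule ℤ R).neg_mem hx)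
    (mul_mem_jacobsonRadical hx y)

/-- The right quasi-inverse `y` of `x` has a right quasi-inverse `z` of its own. In the monoid of
the circle product this makes `y` a two-sided inverse. -/
theorem isQuasiregular_of_mem_jacobsonRadical {x : R} (hx : x ∈ jacobsonRadical R) :
    IsQuasiregular x := by
  obtain ⟨y, hy, hxy⟩ := exists_add_add_mul_eq_zero hx
  obtain ⟨z, -, hyz⟩ := exists_add_add_mul_eq_zero hy
  have h1 : PreQuasiregular.equiv x * PreQuasiregular.equiv y = 1 :=
    PreQuasiregular.equiv.symm.injective hxy
  have h2 : PreQuasiregular.equiv y * PreQuasiregular.equiv z = 1 :=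
    PreQuasiregular.equiv.symm.injective hyz
  have h3 := left_inv_eq_right_inv h1 h2
  rw [isQuasiregular_iff']
  exact ⟨⟨_, _, h1, h3 ▸ h2⟩, rfl⟩

end Ideals

/-! ### The Jacobson radical of a Banach algebra -/

section Banach

variable {A B : Type*}
  [NonUnitalNormedRing A] [NormedSpace ℂ A] [IsScalarTower ℂ A A] [SMulCommClass ℂ A A]
  [NonUnitalNormedRing B] [NormedSpace ℂ B] [IsScalarTower ℂ B B] [SMulCommClass ℂ B B]

/-- `B` is an ideal of its unitization, so the inverse of `1 - r` maps `B` to itself. -/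
theorem exists_sub_mul_eq {r : B} (hr : IsUnit (1 - (r : Unitization ℂ B))) (b : B) :
    ∃ c, c - r * c = b := by
  obtain ⟨w, hw⟩ := hr.exists_right_inv
  have h : (1 - (r : Unitization ℂ B)) * (w * b) = b := by rw [← mul_assoc, hw, one_mul]
  have h0 : (w * (b : Unitization ℂ B)).fst = 0 := by simp
  generalize w * (b : Unitization ℂ B) = v at h h0
  have h2 : ((1 - (r : Unitization ℂ B)) * v).snd = (b : Unitization ℂ B).snd := by rw [h]
  rw [sub_mul, one_mul, sub_eq_add_neg, Unitization.snd_add, Unitization.snd_neg,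
    Unitization.snd_mul, h0] at h2
  exact ⟨v.snd, by simpa [sub_eq_add_neg] using h2⟩

theorem isUnit_one_sub_inr_iff (r : B) :
    IsUnit (1 - (r : Unitization ℂ B)) ↔
      IsUnit (1 - WithLp.toLp 1 (r : Unitization ℂ B)) := by
  rw [← isUnit_map_iff (WithLp.unitizationAlgEquiv (𝕜 := ℂ) (A := B) ℂ), map_sub, map_one]
  rfl

/-- If `I` were dense, some `y ∈ I` would satisfy `‖e - y‖ < 1`. Then `1 - (e - y)` is invertible,
and every element has the form `c - (e - y) * c = y * c - (e * c - c)`, which is in `I`. -/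
theorem IsMaximalRegularRightIdeal.isClosed [CompleteSpace B] {I : AddSubgroup B}
    (hI : IsMaximalRegularRightIdeal I) : IsClosed (I : Set B) := by
  obtain ⟨⟨hr, e, he⟩, hne, hmax⟩ := hI
  have h : I.topologicalClosure = I := by
    refine hmax _ (fun x hx r => ?_) I.le_topologicalClosure fun htop => hne ?_
    · exact map_mem_closure (f := fun x => x * r) (by fun_prop) hx fun y hy => hr y hy r
    · have : e ∈ closure (I : Set B) := (htop ▸ AddSubgroup.mem_top e : e ∈ I.topologicalClosure)
      obtain ⟨y, hy, hey⟩ := Metric.mem_closure_iff.1 this 1 one_pos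
      refine (AddSubgroup.eq_top_iff' _).2 fun b => ?_
      obtain ⟨c, rfl⟩ := exists_sub_mul_eq (r := e - y) ((isUnit_one_sub_inr_iff _).2
        (isUnit_one_sub_of_norm_lt_one (by
          rwa [WithLp.unitization_norm_inr, ← dist_eq_norm]))) b
      have h3 := I.sub_mem (hr y hy c) (he c)
      rwa [show y * c - (e * c - c) = c - (e - y) * c by rw [sub_mul]; abel] at h3
  rw [← h]
  exact I.isClosed_topologicalClosure

theorem isClosed_jacobsonSubmodule [CompleteSpace B] :
    IsClosed (jacobsonSubmodule ℂ B : Set B) := by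
  have h : (jacobsonSubmodule ℂ B : Set B) =
      ⋂ (I : AddSubgroup B) (_ : IsMaximalRegularRightIdeal I), (I : Set B) := by
    ext x
    simp only [Set.mem_iInter]
    rfl
  rw [h]
  exact isClosed_iInter fun I => isClosed_iInter fun hI => hI.isClosed

/-- For `c ≠ 0` the element `-c⁻¹ x` is still in the radical, hence quasiregular, so `c` is not in
the spectrum. -/
theorem spectralRadius_eq_zero_of_mem_jacobsonRadical {x : B} (hx : x ∈ jacobsonRadical B) :
    spectralRadius ℂ (WithLp.toLp 1 (x : Unitization ℂ B)) = 0 := by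
  simp only [spectralRadius, ENNReal.iSup_eq_zero]
  intro c hc
  have h1 : c ∈ spectrum ℂ (x : Unitization ℂ B) := by
    rw [← AlgEquiv.spectrum_eq (WithLp.unitizationAlgEquiv (𝕜 := ℂ) (A := B) ℂ)] at hc
    exact hc
  rw [← Unitization.quasispectrum_eq_spectrum_inr] at h1
  by_contra h0
  have hc0 : c ≠ 0 := by
    rintro rfl
    simp at h0
  refine h1 hc0.isUnit (isQuasiregular_of_mem_jacobsonRadical ?_)
  exact (jacobsonSubmodule ℂ B).neg_mem
    ((jacobsonSubmodule ℂ B).smul_mem ((hc0.isUnit.unit⁻¹ : ℂˣ) : ℂ) hx)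

/-- The spectrum may shrink in a larger algebra, but Gelfand's formula sees only norms of powers.
With the `ℓ¹` norm on the unitizations, the unital extension of `φ` is still isometric. -/
theorem spectralRadius_map_of_isometric [CompleteSpace A] [CompleteSpace B] (φ : A →ₙₐ[ℂ] B)
    (hφ : ∀ a, ‖φ a‖ = ‖a‖) (a : A) :
    spectralRadius ℂ (WithLp.toLp 1 (φ a : Unitization ℂ B)) =
      spectralRadius ℂ (WithLp.toLp 1 (a : Unitization ℂ A)) := by
  let Ψ : Unitization ℂ A →ₐ[ℂ] Unitization ℂ B :=
    Unitization.lift ((Unitization.inrNonUnitalAlgHom ℂ B).comp φ)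
  let Φ : WithLp 1 (Unitization ℂ A) →ₐ[ℂ] WithLp 1 (Unitization ℂ B) :=
    ((WithLp.unitizationAlgEquiv ℂ).symm.toAlgHom.comp Ψ).comp
      (WithLp.unitizationAlgEquiv ℂ).toAlgHom
  have hΨ : ∀ x, Ψ x = Unitization.inl x.fst + (φ x.snd : Unitization ℂ B) := fun x => by
    simp [Ψ, Unitization.algebraMap_eq_inl]
  have hnorm : ∀ x, ‖Φ x‖₊ = ‖x‖₊ := fun x => by
    apply NNReal.eq
    change ‖Φ x‖ = ‖x‖
    rw [WithLp.unitization_norm_def, WithLp.unitization_norm_def]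
    change ‖(Ψ x.ofLp).fst‖ + ‖(Ψ x.ofLp).snd‖ = _
    rw [hΨ]
    simp [hφ]
  have ha : Φ (WithLp.toLp 1 (a : Unitization ℂ A)) =
      WithLp.toLp 1 (φ a : Unitization ℂ B) := by
    change WithLp.toLp 1 (Ψ (a : Unitization ℂ A)) = _
    rw [hΨ]
    simp
  refine tendsto_nhds_unique (spectrum.pow_nnnorm_pow_one_div_tendsto_nhds_spectralRadius _) ?_
  simp_rw [← ha, ← map_pow, hnorm]
  exact spectrum.pow_nnnorm_pow_one_div_tendsto_nhds_spectralRadius _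

theorem mem_jacobsonRadical_of_isometric [CompleteSpace A] [CompleteSpace B] (φ : A →ₙₐ[ℂ] B)
    (hφ : ∀ a, ‖φ a‖ = ‖a‖) {x : A} (hx : φ x ∈ jacobsonRadical B) : x ∈ jacobsonRadical A := by
  intro I hI
  by_contra hxI
  have hmem := fun h => hxI (hI.mem_of_forall_mul_mem h)
  obtain ⟨⟨hr, e, he⟩, hne, hmax⟩ := hI
  -- Otherwise maximality gives `x * A ⊆ I`, and then `x ∈ I`. So `e = i + x * b` with `i ∈ I`;
  -- invertibility of `1 - x * b` will put every `c - x * b * c = i * c - (e * c - c)` into `I`.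
  have htop : I ⊔ (AddMonoidHom.mulLeft x).range = ⊤ := by
    by_contra h
    have h2 := hmax _ (fun y hy r => ?_) le_sup_left h
    · refine hmem fun b => ?_
      rw [← h2]
      exact (le_sup_right : _ ≤ I ⊔ (AddMonoidHom.mulLeft x).range) ⟨b, rfl⟩
    · obtain ⟨i, hi, _, ⟨b, rfl⟩, rfl⟩ := AddSubgroup.mem_sup.1 hy
      rw [add_mul]
      exact AddSubgroup.add_mem_sup (hr i hi r) ⟨b * r, (mul_assoc x b r).symm⟩
  obtain ⟨i, hi, _, ⟨b, rfl⟩, hie⟩ := AddSubgroup.mem_sup.1 (htop ▸ AddSubgroup.mem_top e)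
  have hie' : i + x * b = e := hie
  have h0 : spectralRadius ℂ (WithLp.toLp 1 ((x * b : A) : Unitization ℂ A)) = 0 := by
    rw [← spectralRadius_map_of_isometric φ hφ, map_mul]
    exact spectralRadius_eq_zero_of_mem_jacobsonRadical (mul_mem_jacobsonRadical hx _)
  have hu : IsUnit (1 - ((x * b : A) : Unitization ℂ A)) := by
    rw [isUnit_one_sub_inr_iff]
    have := spectrum.mem_resolventSet_of_spectralRadius_lt (𝕜 := ℂ) (k := 1)
      (a := WithLp.toLp 1 ((x * b : A) : Unitization ℂ A)) (by rw [h0]; simp)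
    rw [spectrum.mem_resolventSet_iff] at this
    simpa using this
  refine hne ((AddSubgroup.eq_top_iff' _).2 fun d => ?_)
  obtain ⟨c, rfl⟩ := exists_sub_mul_eq hu d
  have h3 := I.sub_mem (hr i hi c) (he c)
  rwa [← hie', add_mul, show i * c - (i * c + x * b * c - c) = c - x * b * c by abel] at h3

end Banach

/-! ### Fourier analysis on the dual of a discrete abelian group -/

section Fourier

open MeasureTheory

variable {G : Type*} [CommGroup G] [TopologicalSpace G]

/-- Characters with values in `ℚ/ℤ` separate the points of an abelian group, and `q ↦ exp(2πiq)`
embeds `ℚ/ℤ` in the circle. -/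
theorem exists_pontryaginDual_apply_ne_one [DiscreteTopology G] {g : G} (hg : g ≠ 1) :
    ∃ χ : PontryaginDual G, χ g ≠ 1 := by
  obtain ⟨c, hc⟩ := CharacterModule.exists_character_apply_ne_zero_of_ne_zero
    (A := Additive G) (a := Additive.ofMul g) hg
  let e : ℚ →+ Additive Circle :=
    { toFun := fun q => Additive.ofMul (Circle.exp (2 * Real.pi * q))
      map_zero' := by simp
      map_add' := fun p q => by simp [mul_add, Circle.exp_add] }
  have he : ∀ q : ℚ, e q = 0 ↔ ∃ n : ℤ, (n : ℚ) = q := fun q => by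
    change Circle.exp (2 * Real.pi * q) = 1 ↔ _
    rw [Circle.exp_eq_one]
    refine exists_congr fun n => ⟨fun h => ?_, fun h => ?_⟩
    · have h2 : (2 * Real.pi) * (q : ℝ) = (2 * Real.pi) * n := by rw [h, mul_comm]
      exact_mod_cast (mul_left_cancel₀ Real.two_pi_pos.ne' h2).symm
    · rw [← h]
      push_cast
      ring
  let E : AddCircle (1 : ℚ) →+ Additive Circle := QuotientAddGroup.lift _ e fun q hq => by
    obtain ⟨n, rfl⟩ := AddSubgroup.mem_zmultiples_iff.1 hq
    exact (he _).2 ⟨n, by simp⟩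
  have hE : ∀ x, E x = 0 → x = 0 := fun x => by
    induction x using QuotientAddGroup.induction_on with
    | H q =>
      intro h
      obtain ⟨n, rfl⟩ := (he q).1 h
      exact (QuotientAddGroup.eq_zero_iff _).2 (AddSubgroup.mem_zmultiples_iff.2 ⟨n, by simp⟩)
  let f : Additive G →+ Additive Circle := E.comp (show Additive G →+ AddCircle (1 : ℚ) from c)
  let χ : G →ₜ* Circle := { toMonoidHom := AddMonoidHom.toMultiplicative f
                            continuous_toFun := continuous_of_discreteTopology }
  exact ⟨(χ : PontryaginDual G), fun h => hc (hE _ h)⟩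

/-- Evaluation of characters at a group element, as a continuous function on the dual group. -/
noncomputable def dualEval (s : G) : C(PontryaginDual G, ℂ) where
  toFun χ := (χ s : ℂ)
  continuous_toFun := continuous_subtype_val.comp
    (show Continuous fun χ : G →ₜ* Circle => χ s from
      ContinuousEvalConst.continuous_eval_const s)

@[simp]
theorem dualEval_apply (s : G) (χ : PontryaginDual G) : dualEval s χ = (χ s : ℂ) := rfl

theorem dualEval_mul (s t : G) : dualEval (s * t) = dualEval s * dualEval t := by
  ext χ
  simp

theorem dualEval_one : dualEval (1 : G) = 1 := by
  ext χ
  simp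

theorem star_dualEval (s : G) : star (dualEval s) = dualEval s⁻¹ := by
  ext χ
  simp [← Circle.coe_inv_eq_conj]

theorem norm_dualEval_apply (s : G) (χ : PontryaginDual G) : ‖dualEval s χ‖ = 1 :=
  Circle.norm_coe _

variable [DiscreteTopology G]

/-- The Borel measurable structure on the dual group. -/
noncomputable local instance dualMeasurableSpace : MeasurableSpace (PontryaginDual G) := borel _

local instance dualBorelSpace : BorelSpace (PontryaginDual G) := ⟨rfl⟩

variable (G) in
/-- Normalized Haar measure on the dual of a discrete group. -/
noncomputable def dualHaar : Measure (PontryaginDual G) := Measure.haarMeasure ⊤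

instance : IsProbabilityMeasure (dualHaar G) :=
  ⟨Measure.haarMeasure_self⟩

instance : (dualHaar G).IsHaarMeasure :=
  inferInstanceAs (Measure.haarMeasure (⊤ : TopologicalSpace.PositiveCompacts
    (PontryaginDual G))).IsHaarMeasure

variable {E : Type*} [NormedAddCommGroup E]

theorem integrable_dualHaar {f : PontryaginDual G → E} (hf : Continuous f) :
    Integrable f (dualHaar G) :=
  hf.integrable_of_hasCompactSupport (HasCompactSupport.of_compactSpace f)

/-- Translating by a character `ψ` with `ψ s ≠ 1` multiplies the integral by `ψ s` and, by
invariance of Haar measure, leaves it unchanged. -/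
theorem integral_dualEval {s : G} (hs : s ≠ 1) : ∫ χ, dualEval s χ ∂dualHaar G = 0 := by
  obtain ⟨ψ, hψ⟩ := exists_pontryaginDual_apply_ne_one hs
  have h := integral_mul_left_eq_self (μ := dualHaar G) (fun χ => dualEval s χ) ψ
  have h2 : ∀ χ : PontryaginDual G, dualEval s (ψ * χ) = dualEval s ψ * dualEval s χ :=
    fun χ => by
      rw [dualEval_apply, show (ψ * χ) s = ψ s * χ s from rfl, Circle.coe_mul]
      rfl
  simp_rw [h2] at h
  rw [integral_const_mul] at h
  have h3 : (dualEval s ψ - 1) * ∫ χ, dualEval s χ ∂dualHaar G = 0 := by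
    rw [sub_mul, h, one_mul, sub_self]
  refine (mul_eq_zero.1 h3).resolve_left fun h4 => hψ ?_
  exact Circle.ext (sub_eq_zero.1 h4)

/-- Stone–Weierstrass. The evaluations are closed under products and conjugation, so their linear
span is already the star algebra that they generate. -/
theorem span_dualEval_dense :
    (Submodule.span ℂ (Set.range (dualEval (G := G)))).topologicalClosure = ⊤ := by
  let S : Submonoid C(PontryaginDual G, ℂ) :=
    { carrier := Set.range dualEval
      mul_mem' := by
        rintro _ _ ⟨s, rfl⟩ ⟨t, rfl⟩
        exact ⟨s * t, dualEval_mul s t⟩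
      one_mem' := ⟨1, dualEval_one⟩ }
  let A : StarSubalgebra ℂ C(PontryaginDual G, ℂ) :=
    { Algebra.adjoin ℂ (Set.range (dualEval (G := G))) with
      star_mem' := fun {a} ha => by
        change star a ∈ Algebra.adjoin ℂ _
        have h : star (Set.range (dualEval (G := G))) = Set.range dualEval := by
          ext f
          constructor
          · rintro ⟨s, hs⟩
            exact ⟨s⁻¹, by rw [← star_dualEval, hs, star_star]⟩
          · rintro ⟨s, rfl⟩
            exact ⟨s⁻¹, (star_dualEval s).symm⟩
        rw [← h, ← Subalgebra.star_mem_star_iff, star_star, Subalgebra.star_adjoin_comm,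
          star_star]
        exact ha }
  have hA : A.SeparatesPoints := by
    intro χ ψ h
    obtain ⟨s, hs⟩ : ∃ s, χ s ≠ ψ s := by
      by_contra! h'
      exact h (PontryaginDual.ext h')
    exact ⟨dualEval s, ⟨dualEval s, Algebra.subset_adjoin ⟨s, rfl⟩, rfl⟩,
      fun h' => hs (Circle.ext h')⟩
  have h := ContinuousMap.starSubalgebra_topologicalClosure_eq_top_of_separatesPoints A hA
  have hspan : Submodule.span ℂ (Set.range (dualEval (G := G))) =
      Subalgebra.toSubmodule (Algebra.adjoin ℂ (Set.range (dualEval (G := G)))) := by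
    rw [Algebra.adjoin_eq_span]
    congr 1
    exact congrArg SetLike.coe (Submonoid.closure_eq S).symm
  rw [hspan]
  refine (Submodule.eq_top_iff'.2 fun f => ?_)
  have hf : f ∈ A.topologicalClosure := h ▸ StarSubalgebra.mem_top
  exact hf

variable [NormedSpace ℂ E] [CompleteSpace E]

/-- By density the hypothesis extends from evaluations to all continuous weights `k`. For a
functional `φ`, the weight `k = conj (φ ∘ f)` gives `∫ |φ(f)|² = 0`, and Haar measure charges every
nonempty open set. -/
theorem eq_zero_of_integral_dualEval_smul_eq_zero {f : PontryaginDual G → E} (hf : Continuous f)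
    (h : ∀ s, ∫ χ, dualEval s χ • f χ ∂dualHaar G = 0) : f = 0 := by
  have key : ∀ k : C(PontryaginDual G, ℂ), ∫ χ, k χ • f χ ∂dualHaar G = 0 := by
    obtain ⟨M, hM⟩ := isCompact_univ.exists_bound_of_continuousOn hf.continuousOn
    let T : C(PontryaginDual G, ℂ) →ₗ[ℂ] E :=
      { toFun := fun k => ∫ χ, k χ • f χ ∂dualHaar G
        map_add' := fun a b => by
          simp only [ContinuousMap.add_apply, add_smul]
          exact integral_add (integrable_dualHaar (by fun_prop)) (integrable_dualHaar (by fun_prop))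
        map_smul' := fun c a => by
          simp only [ContinuousMap.smul_apply, smul_assoc]
          exact integral_smul _ _ }
    have hT : Continuous T := AddMonoidHomClass.continuous_of_bound T M fun k => by
      refine (norm_integral_le_of_norm_le_const (C := M * ‖k‖) (.of_forall fun χ => ?_)).trans
        (by simp)
      rw [norm_smul, mul_comm]
      exact mul_le_mul (hM χ trivial) (k.norm_coe_le_norm χ) (norm_nonneg _)
        ((norm_nonneg _).trans (hM χ trivial))
    let N : Submodule ℂ C(PontryaginDual G, ℂ) := LinearMap.ker T
    have hN : IsClosed (N : Set C(PontryaginDual G, ℂ)) := isClosed_eq hT continuous_const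
    have hle : (⊤ : Submodule ℂ C(PontryaginDual G, ℂ)) ≤ N := by
      rw [← span_dualEval_dense]
      refine Submodule.topologicalClosure_minimal _ (Submodule.span_le.2 ?_) hN
      rintro _ ⟨s, rfl⟩
      exact h s
    exact fun k => hle Submodule.mem_top
  funext ψ
  refine (SeparatingDual.eq_zero_iff_forall_dual_eq_zero (R := ℂ) _).2 fun φ => ?_
  let k : C(PontryaginDual G, ℂ) := ⟨fun χ => star (φ (f χ)), by fun_prop⟩
  have h1 := congrArg φ (key k)
  rw [map_zero, ← ContinuousLinearMap.integral_comp_comm _ (integrable_dualHaar (by fun_prop))]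
    at h1
  have h2 : ∀ χ, φ (k χ • f χ) = ((‖φ (f χ)‖ ^ 2 : ℝ) : ℂ) := fun χ => by
    rw [map_smul, smul_eq_mul, Complex.ofReal_pow]
    exact Complex.conj_mul' _
  simp_rw [h2] at h1
  rw [integral_complex_ofReal, Complex.ofReal_eq_zero] at h1
  have hc : Continuous fun χ => ‖φ (f χ)‖ ^ 2 := by fun_prop
  rw [integral_eq_zero_iff_of_nonneg (fun χ => by positivity) (integrable_dualHaar hc)] at h1
  have h3 := congrFun ((Continuous.ae_eq_iff_eq _ hc continuous_zero).1 h1) ψ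
  simpa using h3

end Fourier

/-! ### Graded Banach algebras with a dual action -/

section DualAction

open MeasureTheory

variable {G : Type*} [CommGroup G] [TopologicalSpace G]
  {E F : Type*} [NormedAddCommGroup E] [NormedSpace ℂ E]
  [NormedAddCommGroup F] [NormedSpace ℂ F]


attribute [local instance] dualMeasurableSpace dualBorelSpace

variable [DiscreteTopology G] in
/-- The Fourier coefficient at `s` of a vector for a family of operators that is indexed by the
dual group. -/
noncomputable def fourierCoeff (θ : PontryaginDual G → F →ₗ[ℂ] F) (s : G) (x : F) : F :=
  ∫ χ, dualEval s⁻¹ χ • θ χ x ∂dualHaar G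

/-! ### Fourier coefficients pick out the homogeneous components. -/

section Coefficients

variable {θ : PontryaginDual G → F →ₗ[ℂ] F} {m : G → E →ₗ[ℂ] F}

/-- The orbit map of a monomial is visibly continuous. Contractivity of `θ` makes orbit maps of
limits uniform limits, so the vectors with continuous orbit map form a closed subspace. -/
theorem continuous_dual_action (hθ : ∀ χ x, ‖θ χ x‖ ≤ ‖x‖)
    (hθm : ∀ χ s a, θ χ (m s a) = (χ s : ℂ) • m s a)
    (hdense : (⨆ s, LinearMap.range (m s)).topologicalClosure = ⊤) (x : F) :
    Continuous fun χ => θ χ x := by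
  let N : Submodule ℂ F :=
    { carrier := {x | Continuous fun χ => θ χ x}
      zero_mem' := by simp [continuous_const]
      add_mem' := fun {a b} (ha : Continuous _) (hb : Continuous _) => by
        change Continuous fun χ => θ χ (a + b)
        simp_rw [map_add]
        exact ha.add hb
      smul_mem' := fun c a (ha : Continuous _) => by
        change Continuous fun χ => θ χ (c • a)
        simp_rw [map_smul]
        exact ha.const_smul c }
  have hN : IsClosed (N : Set F) := by
    refine isClosed_of_closure_subset fun x hx => ?_
    refine continuous_of_uniform_approx_of_continuous fun u hu => ?_
    obtain ⟨ε, hε, hεu⟩ := Metric.mem_uniformity_dist.1 hu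
    obtain ⟨y, hy, hxy⟩ := Metric.mem_closure_iff.1 hx ε hε
    refine ⟨fun χ => θ χ y, hy, fun χ => hεu ?_⟩
    rw [dist_eq_norm, ← map_sub]
    exact (hθ χ _).trans_lt (by rwa [← dist_eq_norm])
  have hle : (⊤ : Submodule ℂ F) ≤ N := by
    rw [← hdense]
    refine Submodule.topologicalClosure_minimal _ (iSup_le fun s => ?_) hN
    rintro _ ⟨a, rfl⟩
    change Continuous fun χ => θ χ (m s a)
    simp_rw [hθm]
    exact (dualEval s).continuous.smul continuous_const
  exact hle Submodule.mem_top

variable [DiscreteTopology G] [CompleteSpace F]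

theorem fourierCoeff_apply_of_eq (hθm : ∀ χ s a, θ χ (m s a) = (χ s : ℂ) • m s a) (s : G)
    (a : E) : fourierCoeff θ s (m s a) = m s a := by
  have h : ∀ χ : PontryaginDual G, dualEval s⁻¹ χ • θ χ (m s a) = m s a := fun χ => by
    rw [hθm, smul_smul, ← dualEval_apply, ← ContinuousMap.mul_apply, ← dualEval_mul,
      inv_mul_cancel, dualEval_one, ContinuousMap.one_apply, one_smul]
  simp_rw [fourierCoeff, h]
  simp

theorem fourierCoeff_apply_of_ne (hθm : ∀ χ s a, θ χ (m s a) = (χ s : ℂ) • m s a) {s t : G}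
    (hst : t ≠ s) (a : E) : fourierCoeff θ s (m t a) = 0 := by
  have h : ∀ χ : PontryaginDual G, dualEval s⁻¹ χ • θ χ (m t a) =
      dualEval (s⁻¹ * t) χ • m t a := fun χ => by
    rw [hθm, smul_smul, ← dualEval_apply, ← ContinuousMap.mul_apply, ← dualEval_mul]
  simp_rw [fourierCoeff, h]
  rw [integral_smul_const, integral_dualEval, zero_smul]
  rwa [ne_eq, inv_mul_eq_one, eq_comm]

/-- The coefficient map is continuous, fixes the component at `s` and kills the others. The range of
the isometry `m s` is closed, so density concludes. -/
theorem fourierCoeff_mem_range [CompleteSpace E] (hm : ∀ s a, ‖m s a‖ = ‖a‖)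
    (hθ : ∀ χ x, ‖θ χ x‖ ≤ ‖x‖)
    (hθm : ∀ χ s a, θ χ (m s a) = (χ s : ℂ) • m s a)
    (hdense : (⨆ s, LinearMap.range (m s)).topologicalClosure = ⊤) (s : G) (x : F) :
    ∃ a, m s a = fourierCoeff θ s x := by
  have hc := continuous_dual_action hθ hθm hdense
  let Φ : F →ₗ[ℂ] F :=
    { toFun := fourierCoeff θ s
      map_add' := fun x y => by
        simp only [fourierCoeff, map_add, smul_add]
        exact integral_add
          (integrable_dualHaar ((dualEval s⁻¹).continuous.smul (hc x)))
          (integrable_dualHaar ((dualEval s⁻¹).continuous.smul (hc y)))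
      map_smul' := fun c x => by
        simp only [fourierCoeff, map_smul, smul_comm _ c]
        exact integral_smul _ _ }
  have hΦ : Continuous Φ := AddMonoidHomClass.continuous_of_bound Φ 1 fun x => by
    refine (norm_integral_le_of_norm_le_const (C := ‖x‖) (.of_forall fun χ => ?_)).trans
      (by simp)
    rw [norm_smul, norm_dualEval_apply, one_mul]
    exact hθ χ x
  have hiso : Isometry (m s) := AddMonoidHomClass.isometry_of_norm _ (hm s)
  have hr : IsClosed (LinearMap.range (m s) : Set F) := hiso.isClosedEmbedding.isClosed_range
  have hle : (⊤ : Submodule ℂ F) ≤ (LinearMap.range (m s)).comap Φ := by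
    rw [← hdense]
    refine Submodule.topologicalClosure_minimal _ (iSup_le fun t => ?_) (hr.preimage hΦ)
    rintro _ ⟨a, rfl⟩
    by_cases hst : t = s
    · subst hst
      exact ⟨a, (fourierCoeff_apply_of_eq hθm t a).symm⟩
    · exact ⟨0, by rw [map_zero]; exact (fourierCoeff_apply_of_ne hθm hst a).symm⟩
  exact hle Submodule.mem_top

end Coefficients

variable [DiscreteTopology G] {A B : Type*}
  [NonUnitalNormedRing A] [NormedSpace ℂ A] [IsScalarTower ℂ A A] [SMulCommClass ℂ A A]
  [CompleteSpace A]
  [NonUnitalNormedRing B] [NormedSpace ℂ B] [IsScalarTower ℂ B B] [SMulCommClass ℂ B B]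
  [CompleteSpace B]

/-- Here `m s a` stands for `a U_s`, `σ` for the action on `A` and `θ` for the dual action. -/
theorem jacobsonRadical_eq_of_dual_action {m : G → A →ₗ[ℂ] B} {σ : G → A → A}
    (hm : ∀ s a, ‖m s a‖ = ‖a‖) (hmul : ∀ s t a b, m s a * m t b = m (s * t) (a * σ s b))
    (hσ : ∀ s, Function.Surjective (σ s)) (hσ1 : ∀ a, σ 1 a = a)
    (hdense : (⨆ s, LinearMap.range (m s)).topologicalClosure = ⊤)
    {θ : PontryaginDual G → B →ₙₐ[ℂ] B} (hθ : ∀ χ x, ‖θ χ x‖ ≤ ‖x‖)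
    (hθm : ∀ χ s a, θ χ (m s a) = (χ s : ℂ) • m s a) (hA : IsSemisimple A) :
    IsSemisimple B := by
  let θl : PontryaginDual G → B →ₗ[ℂ] B := fun χ => (θ χ : B →ₗ[ℂ] B)
  have hinv : ∀ χ ψ : PontryaginDual G, χ * ψ = 1 → ∀ x, θ χ (θ ψ x) = x := by
    intro χ ψ h x
    let N : Submodule ℂ B := LinearMap.eqLocus (θl χ ∘ₗ θl ψ) LinearMap.id
    have hcont : ∀ χ, Continuous (θl χ) := fun χ =>
      AddMonoidHomClass.continuous_of_bound (θl χ) 1 fun x => by rw [one_mul]; exact hθ χ x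
    have hN : IsClosed (N : Set B) :=
      isClosed_eq ((hcont χ).comp (hcont ψ)) continuous_id
    have hle : (⊤ : Submodule ℂ B) ≤ N := by
      rw [← hdense]
      refine Submodule.topologicalClosure_minimal _ (iSup_le fun s => ?_) hN
      rintro _ ⟨a, rfl⟩
      change θ χ (θ ψ (m s a)) = m s a
      have h1 : χ s * ψ s = 1 := congrArg (fun ω : PontryaginDual G => ω s) h
      rw [hθm, map_smul, hθm, smul_smul, ← Circle.coe_mul, mul_comm, h1, Circle.coe_one, one_smul]
    exact hle Submodule.mem_top
  have hbij : ∀ χ, Function.Bijective (θ χ) := fun χ =>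
    Function.bijective_iff_has_inverse.2
      ⟨θ χ⁻¹, hinv _ _ (inv_mul_cancel χ), hinv _ _ (mul_inv_cancel χ)⟩
  let φ : A →ₙₐ[ℂ] B :=
    { m 1 with
      map_zero' := map_zero (m 1)
      map_mul' := fun a b => by
        change m 1 (a * b) = m 1 a * m 1 b
        rw [hmul, hσ1, one_mul] }
  -- Right multiplication by `m s⁻¹ c` moves the monomial to degree `1`, where `φ` embeds `A`
  -- isometrically; surjectivity of `σ s` makes `σ s c` arbitrary.
  have hmono : ∀ s a, m s a ∈ jacobsonRadical B → a = 0 := by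
    intro s a ha
    have h : a ∈ jacobsonRadical A := by
      refine mem_jacobsonRadical_of_forall_mul_mem fun b => ?_
      obtain ⟨c, rfl⟩ := hσ s b
      refine mem_jacobsonRadical_of_isometric φ (hm 1) ?_
      change m 1 (a * σ s c) ∈ _
      rw [← mul_inv_cancel s, ← hmul]
      exact mul_mem_jacobsonRadical ha _
    rw [hA] at h
    exact h
  refine Set.Subset.antisymm (fun x hx => ?_) ?_
  · have hc : Continuous fun χ => θl χ x := continuous_dual_action hθ hθm hdense x
    have hzero : ∀ s, fourierCoeff θl s x = 0 := by
      intro s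
      obtain ⟨a, ha⟩ := fourierCoeff_mem_range (θ := θl) hm hθ hθm hdense s x
      have hmem : fourierCoeff θl s x ∈ jacobsonSubmodule ℂ B := by
        -- The mean over a probability measure of a function with values in a closed convex set
        -- stays in that set.
        refine Convex.integral_mem (s := (jacobsonSubmodule ℂ B : Set B))
          ((jacobsonSubmodule ℂ B).restrictScalars ℝ).convex isClosed_jacobsonSubmodule
          (.of_forall fun χ => ?_)
          (integrable_dualHaar ((dualEval s⁻¹).continuous.smul hc))
        exact (jacobsonSubmodule ℂ B).smul_mem _ (map_mem_jacobsonRadical (θ χ) (hbij χ) hx)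
      rw [← ha] at hmem ⊢
      rw [hmono s a hmem, map_zero]
    have h := congrFun (eq_zero_of_integral_dualEval_smul_eq_zero hc fun s => by
      have := hzero s⁻¹
      rwa [fourierCoeff, inv_inv] at this) 1
    -- That `θ 1` is the identity is not among the hypotheses; that it is an involution suffices.
    have h2 : θ 1 (θ 1 x) = x := hinv 1 1 (mul_one 1) x
    rw [show θ 1 x = 0 from h, map_zero] at h2
    exact h2.symm
  · rintro _ rfl
    exact (jacobsonSubmodule ℂ B).zero_mem

end DualAction

/-! ### Diagonal operators and permutation operators on Hilbert sums -/

section HilbertSum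

variable {ι : Type*} {E : Type*} [NormedAddCommGroup E]

theorem memℓp_two_of_norm_le {f g : ι → E} (hg : Memℓp g 2) (h : ∀ i, ‖f i‖ ≤ ‖g i‖) :
    Memℓp f 2 :=
  memℓp_gen <| (hg.summable (by norm_num)).of_nonneg_of_le (fun i => by positivity)
    fun i => Real.rpow_le_rpow (norm_nonneg _) (h i) (by norm_num)

theorem norm_le_of_forall_norm_le {f g : lp (fun _ : ι => E) 2} (h : ∀ i, ‖f i‖ ≤ ‖g i‖) :
    ‖f‖ ≤ ‖g‖ :=
  lp.norm_mono (by norm_num) h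

variable [InnerProductSpace ℂ E]

/-- The diagonal operator with the given uniformly bounded diagonal entries. -/
noncomputable def diagOp (T : ι → E →L[ℂ] E) (b : ℝ) (hb : ∀ i, ‖T i‖ ≤ b) :
    lp (fun _ : ι => E) 2 →L[ℂ] lp (fun _ : ι => E) 2 :=
  have h : ∀ (f : lp (fun _ : ι => E) 2) (i : ι),
      ‖T i (f i)‖ ≤ ‖(((|b| : ℝ) : ℂ) • f) i‖ := fun f i => by
    rw [lp.coeFn_smul, Pi.smul_apply, norm_smul, Complex.norm_real, Real.norm_eq_abs, abs_abs]
    exact (T i).le_of_opNorm_le ((hb i).trans (le_abs_self b)) _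
  LinearMap.mkContinuous
    { toFun := fun f => ⟨fun i => T i (f i), memℓp_two_of_norm_le (lp.memℓp _) (h f)⟩
      map_add' := fun f g => lp.ext (funext fun i => map_add (T i) (f i) (g i))
      map_smul' := fun c f => lp.ext (funext fun i => map_smul (T i) c (f i)) }
    |b| fun f => by
      refine (norm_le_of_forall_norm_le (h f)).trans ?_
      rw [norm_smul, Complex.norm_real, Real.norm_eq_abs, abs_abs]

theorem diagOp_apply (T : ι → E →L[ℂ] E) (b : ℝ) (hb : ∀ i, ‖T i‖ ≤ b)
    (f : lp (fun _ : ι => E) 2) (i : ι) : diagOp T b hb f i = T i (f i) := rfl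

theorem star_diagOp [CompleteSpace E] (T : ι → E →L[ℂ] E) (b : ℝ) (hb : ∀ i, ‖T i‖ ≤ b)
    (b' : ℝ) (hb' : ∀ i, ‖star (T i)‖ ≤ b') :
    star (diagOp T b hb) = diagOp (fun i => star (T i)) b' hb' := by
  rw [ContinuousLinearMap.star_eq_adjoint, eq_comm, ContinuousLinearMap.eq_adjoint_iff]
  intro f g
  rw [lp.inner_eq_tsum, lp.inner_eq_tsum]
  refine tsum_congr fun i => ?_
  rw [diagOp_apply, diagOp_apply]
  exact ContinuousLinearMap.adjoint_inner_left (T i) (g i) (f i)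

/-- The isometric operator that permutes the summands of a Hilbert sum. -/
noncomputable def permOp (e : ι ≃ ι) :
    lp (fun _ : ι => E) 2 ≃ₗᵢ[ℂ] lp (fun _ : ι => E) 2 where
  toFun f := ⟨fun i => f (e.symm i), memℓp_gen
    (e.symm.summable_iff.2 ((lp.memℓp f).summable (by norm_num)))⟩
  invFun f := ⟨fun i => f (e i), memℓp_gen
    (e.summable_iff.2 ((lp.memℓp f).summable (by norm_num)))⟩
  map_add' _ _ := rfl
  map_smul' _ _ := rfl
  left_inv f := lp.ext (funext fun i => congrArg f (e.symm_apply_apply i))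
  right_inv f := lp.ext (funext fun i => congrArg f (e.apply_symm_apply i))
  norm_map' f := by
    rw [lp.norm_eq_tsum_rpow (by norm_num), lp.norm_eq_tsum_rpow (by norm_num) f]
    exact congrArg (· ^ _) (e.symm.tsum_eq fun i => ‖f i‖ ^ (2 : ℝ≥0∞).toReal)

theorem permOp_apply (e : ι ≃ ι) (f : lp (fun _ : ι => E) 2) (i : ι) :
    permOp e f i = f (e.symm i) := rfl

end HilbertSum

/-! ### The regular representation of the maximal C⋆-algebra -/

section Regular

variable {H : Type u} [NormedAddCommGroup H] [InnerProductSpace ℂ H] [CompleteSpace H]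
  {A : NonUnitalSubalgebra ℂ (H →L[ℂ] H)} {G : Type v} [Group G]

variable (A) in
/-- The identity representation of an operator algebra. -/
def CCRep.id : CCRep A where
  K := H
  π := NonUnitalSubalgebraClass.subtype A
  completelyContractive _ _ := le_rfl

variable (A) in
/-- The extension of the identity representation to the maximal C⋆-algebra. -/
def CStarMax.toOperator : CStarMax A →⋆ₙₐ[ℂ] (H →L[ℂ] H) where
  toFun x := CCProd.entry x.1 (CCRep.id A)
  map_smul' _ _ := rfl
  map_zero' := rfl
  map_add' _ _ := rfl
  map_mul' _ _ := rfl
  map_star' _ := rfl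

theorem CStarMax.toOperator_j (a : A) : CStarMax.toOperator A (CStarMax.j A a) = a := rfl

theorem CStarMax.norm_j_le (a : A) : ‖CStarMax.j A a‖ ≤ ‖a‖ :=
  lp.norm_le_of_forall_le (norm_nonneg a) fun r => r.completelyContractive.norm_le a

theorem norm_toOperator_action_le (α : Action G A) (s : G) (c : CStarMax A) :
    ‖CStarMax.toOperator A (CStarMax.action α s c)‖ ≤ ‖c‖ :=
  (NonUnitalStarAlgHom.norm_apply_le _ _).trans
    (NonUnitalStarAlgHom.norm_apply_le (CStarMax.action α s) c)

/-- The left translation of a copy of `G` in a larger universe. -/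
def uliftMulLeft (s : G) : ULift.{w} G ≃ ULift.{w} G := Equiv.mulLeft (ULift.up s)

/-- The diagonal part of the regular representation. -/
noncomputable def regularPi (α : Action G A) :
    CStarMax A →⋆ₙₐ[ℂ] (lp (fun _ : ULift.{u + 1} G => H) 2 →L[ℂ]
      lp (fun _ : ULift.{u + 1} G => H) 2) where
  -- The inverse in `α_{i⁻¹}(c)` is what makes this diagonal operator covariant with left
  -- translation.
  toFun c := diagOp (fun i : ULift.{u + 1} G =>
    CStarMax.toOperator A (CStarMax.action α i.down⁻¹ c)) ‖c‖
    fun i => norm_toOperator_action_le α _ c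
  map_smul' z c := ContinuousLinearMap.ext fun f => lp.ext (funext fun i => by
    simp [diagOp_apply])
  map_zero' := ContinuousLinearMap.ext fun f => lp.ext (funext fun i => by
    simp [diagOp_apply])
  map_add' c d := ContinuousLinearMap.ext fun f => lp.ext (funext fun i => by
    simp [diagOp_apply])
  map_mul' c d := ContinuousLinearMap.ext fun f => lp.ext (funext fun i => by
    simp [diagOp_apply])
  map_star' c := by
    simp_rw [map_star]
    refine (star_diagOp _ _ _ _ fun i => ?_).symm
    rw [norm_star, norm_star]
    exact norm_toOperator_action_le α _ c

theorem regularPi_apply (α : Action G A) (c : CStarMax A)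
    (f : lp (fun _ : ULift.{u + 1} G => H) 2) (i : ULift.{u + 1} G) :
    regularPi α c f i = CStarMax.toOperator A (CStarMax.action α i.down⁻¹ c) (f i) := rfl

variable (G H) in
/-- The translation operators of the regular representation. -/
noncomputable def regularU :
    G →* unitary (lp (fun _ : ULift.{u + 1} G => H) 2 →L[ℂ]
      lp (fun _ : ULift.{u + 1} G => H) 2) :=
  Unitary.linearIsometryEquiv.symm.toMonoidHom.comp
    { toFun := fun s => permOp (uliftMulLeft s)
      map_one' := LinearIsometryEquiv.ext fun f => lp.ext (funext fun i => by
        rw [permOp_apply]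
        exact congrArg f (show 1⁻¹ * i = i by simp))
      map_mul' := fun s t => LinearIsometryEquiv.ext fun f => lp.ext (funext fun i => by
        change f ((ULift.up s * ULift.up t)⁻¹ * i) = f ((ULift.up t)⁻¹ * ((ULift.up s)⁻¹ * i))
        rw [mul_inv_rev, mul_assoc]) }

theorem regularU_apply (s : G) (f : lp (fun _ : ULift.{u + 1} G => H) 2) (i : ULift.{u + 1} G) :
    (regularU H G s).1 f i =
      f ((ULift.up s)⁻¹ * i) := rfl

theorem regularPi_action_mul_regularU (α : Action G A) (s : G) (c : CStarMax A) :
    regularPi α (CStarMax.action α s c) * (regularU H G s).1 =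
      (regularU H G s).1 * regularPi α c := by
  refine ContinuousLinearMap.ext fun f => lp.ext (funext fun i => ?_)
  change regularPi α (CStarMax.action α s c) ((regularU H G s).1 f) i =
    (regularU H G s).1 (regularPi α c f) i
  rw [regularPi_apply, regularU_apply, regularU_apply, regularPi_apply]
  have h : CStarMax.action α i.down⁻¹ (CStarMax.action α s c) =
      CStarMax.action α ((ULift.up s)⁻¹ * i).down⁻¹ c := by
    rw [← StarAlgEquiv.mul_apply, ← map_mul]
    congr 2
    simp
  rw [h]

/-- The regular representation of the dynamical system `(C*_max(A), G, α)` that is induced by the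
identity representation of `A`. -/
noncomputable def regularRep (α : Action G A) : CovariantRep (CStarMax.action α) where
  -- `C*_max(A)` lives one universe above `H`. Indexing by a lifted copy of `G` puts the Hilbert
  -- space in the universe over which covariant representations range.
  K := lp (fun _ : ULift.{u + 1} G => H) 2
  π := regularPi α
  U := regularU H G
  covariant s c := by
    rw [← regularPi_action_mul_regularU, mul_assoc, Unitary.mul_star_self_of_mem (regularU H G s).2,
      mul_one]

/-- On vectors supported at the identity of `G`, the diagonal part acts as the identity
representation of `A`. -/
theorem norm_le_norm_regularRep_j (α : Action G A) (a : A) :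
    ‖a‖ ≤ ‖(regularRep α).π (CStarMax.j A a)‖ := by
  classical
  refine ContinuousLinearMap.opNorm_le_bound _ (norm_nonneg _) fun h => ?_
  let f : lp (fun _ : ULift.{u + 1} G => H) 2 := lp.single 2 1 h
  have hf : ‖f‖ = ‖h‖ := lp.norm_single (by norm_num) _ _
  let g : lp (fun _ : ULift.{u + 1} G => H) 2 := (regularRep α).π (CStarMax.j A a) f
  have hg : g 1 = (a : H →L[ℂ] H) h := by
    change CStarMax.toOperator A (CStarMax.action α 1⁻¹ (CStarMax.j A a)) (f 1) = _
    rw [inv_one, map_one (CStarMax.action α), StarAlgEquiv.one_apply, CStarMax.toOperator_j,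
      lp.single_apply_self]
  calc ‖(a : H →L[ℂ] H) h‖ = ‖g 1‖ := by rw [hg]
    _ ≤ ‖g‖ := lp.norm_apply_le_norm (by norm_num) g 1
    _ ≤ ‖(regularRep α).π (CStarMax.j A a)‖ * ‖f‖ := ContinuousLinearMap.le_opNorm _ _
    _ = _ := by rw [hf]

end Regular

/-! ### The dual action on the crossed product -/

section Dual

variable {C : Type w} [NonUnitalCStarAlgebra C] {G : Type v} [Group G] {β : G →* (C ≃⋆ₐ[ℂ] C)}

theorem covMonomial_add (c d : C) (s : G) :
    covMonomial β (c + d) s = covMonomial β c s + covMonomial β d s :=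
  lp.ext (funext fun r => by
    change r.π (c + d) * (r.U s).1 = r.π c * (r.U s).1 + r.π d * (r.U s).1
    rw [map_add, add_mul])

theorem covMonomial_smul (z : ℂ) (c : C) (s : G) :
    covMonomial β (z • c) s = z • covMonomial β c s :=
  lp.ext (funext fun r => by
    change r.π (z • c) * (r.U s).1 = z • (r.π c * (r.U s).1)
    rw [map_smul, smul_mul_assoc])

theorem covMonomial_zero (s : G) : covMonomial β (0 : C) s = 0 := by
  rw [← zero_smul ℂ (0 : C), covMonomial_smul, zero_smul]

theorem covMonomial_mul (c d : C) (s t : G) :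
    covMonomial β c s * covMonomial β d t = covMonomial β (c * β s d) (s * t) :=
  lp.ext (funext fun r => by
    change r.π c * (r.U s).1 * (r.π d * (r.U t).1) = r.π (c * β s d) * (r.U (s * t)).1
    have h : star (r.U s).1 * (r.U s).1 = 1 := Unitary.star_mul_self_of_mem (r.U s).2
    rw [map_mul, map_mul, r.covariant]
    change _ = r.π c * ((r.U s).1 * r.π d * star (r.U s).1) * ((r.U s).1 * (r.U t).1)
    simp only [mul_assoc]
    rw [← mul_assoc (star (r.U s).1), h, one_mul])

theorem norm_covMonomial_le (c : C) (s : G) : ‖covMonomial β c s‖ ≤ ‖c‖ :=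
  lp.norm_le_of_forall_le (norm_nonneg c) fun r => r.norm_monomial_le c s

/-- Any single covariant representation bounds the norm from below, and the unitary factor does not
change it. -/
theorem norm_le_norm_covMonomial (r : CovariantRep β) (c : C) (s : G) :
    ‖r.π c‖ ≤ ‖covMonomial β c s‖ := by
  rw [← CStarRing.norm_mul_coe_unitary (r.π c) (r.U s)]
  exact lp.norm_apply_le_norm (E := fun r : CovariantRep β => r.K →L[ℂ] r.K)
    ENNReal.top_ne_zero (covMonomial β c s) r

theorem integratedForm_single (s : G) (c : C) :
    integratedForm β (Finsupp.single s c) = covMonomial β c s :=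
  Finsupp.sum_single_index (covMonomial_zero s)

theorem integratedForm_eq_sum (f : G →₀ C) :
    integratedForm β f = ∑ s ∈ f.support, covMonomial β (f s) s := rfl

/-- The product of a unitary representation with a character. -/
noncomputable def twistUnitary {K : Type*} [NormedAddCommGroup K]
    [InnerProductSpace ℂ K] [CompleteSpace K]
    (χ : G →* Circle) (U : G →* unitary (K →L[ℂ] K)) : G →* unitary (K →L[ℂ] K) where
  toFun s := ⟨(χ s : ℂ) • (U s).1, by
    have h : star (χ s : ℂ) * (χ s : ℂ) = 1 := by
      rw [Complex.star_def, ← Circle.coe_inv_eq_conj, ← Circle.coe_mul, inv_mul_cancel,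
        Circle.coe_one]
    rw [Unitary.mem_iff, star_smul, smul_mul_smul_comm, smul_mul_smul_comm, h,
      mul_comm (χ s : ℂ), h, Unitary.star_mul_self_of_mem (U s).2,
      Unitary.mul_star_self_of_mem (U s).2, one_smul]
    exact ⟨rfl, rfl⟩⟩
  map_one' := Subtype.ext <| by
    change (χ 1 : ℂ) • (U 1).1 = 1
    rw [map_one, map_one, Circle.coe_one, one_smul]
    rfl
  map_mul' s t := Subtype.ext <| by
    change (χ (s * t) : ℂ) • (U (s * t)).1 = ((χ s : ℂ) • (U s).1) * ((χ t : ℂ) • (U t).1)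
    rw [map_mul, map_mul, Circle.coe_mul, smul_mul_smul_comm]
    rfl

/-- The covariant representation `(π, χU)` for a character `χ`. -/
noncomputable def CovariantRep.twist (χ : G →* Circle) (r : CovariantRep β) : CovariantRep β where
  K := r.K
  π := r.π
  U := twistUnitary χ r.U
  covariant s c := by
    change r.π (β s c) = ((χ s : ℂ) • (r.U s).1) * r.π c * star ((χ s : ℂ) • (r.U s).1)
    have h : (χ s : ℂ) * star (χ s : ℂ) = 1 := by
      rw [Complex.star_def, ← Circle.coe_inv_eq_conj, ← Circle.coe_mul, mul_inv_cancel,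
        Circle.coe_one]
    rw [star_smul, smul_mul_assoc, smul_mul_smul_comm, h, one_smul, r.covariant]

/-- The ⋆-endomorphism `(x_(π,U)) ↦ (x_(π,χU))` of the product algebra. -/
noncomputable def CovProd.dualShift (χ : G →* Circle) : CovProd β →⋆ₙₐ[ℂ] CovProd β where
  toFun x := ⟨fun r => x.1 (r.twist χ), memℓp_infty ⟨‖x‖, by
    rintro _ ⟨r, rfl⟩
    exact lp.norm_apply_le_norm (E := fun r : CovariantRep β => r.K →L[ℂ] r.K)
      ENNReal.top_ne_zero x (r.twist χ)⟩⟩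
  map_smul' _ _ := rfl
  map_zero' := rfl
  map_add' _ _ := rfl
  map_mul' _ _ := rfl
  map_star' _ := rfl

theorem CovProd.dualShift_covMonomial (χ : G →* Circle) (c : C) (s : G) :
    CovProd.dualShift χ (covMonomial β c s) = (χ s : ℂ) • covMonomial β c s :=
  lp.ext (funext fun r => by
    change r.π c * ((χ s : ℂ) • (r.U s).1) = (χ s : ℂ) • (r.π c * (r.U s).1)
    rw [mul_smul_comm])

theorem CovProd.continuous_dualShift (χ : G →* Circle) :
    Continuous (CovProd.dualShift (β := β) χ) :=
  AddMonoidHomClass.continuous_of_bound (CovProd.dualShift χ) 1 fun x => by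
    rw [one_mul]
    exact NonUnitalStarAlgHom.norm_apply_le (CovProd.dualShift χ) x

theorem CovProd.dualShift_mem (χ : G →* Circle) {x : CovProd β}
    (hx : x ∈ cstarCrossedProductSubalgebra β) :
    CovProd.dualShift χ x ∈ cstarCrossedProductSubalgebra β := by
  have h : cstarCrossedProductSubalgebra β ≤
      (cstarCrossedProductSubalgebra β).comap (CovProd.dualShift χ) := by
    refine NonUnitalStarSubalgebra.topologicalClosure_minimal _
      (NonUnitalStarAlgebra.adjoin_le ?_)
      ((cstarCrossedProductSubalgebra.isClosed β).preimage (CovProd.continuous_dualShift χ))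
    rintro _ ⟨f, rfl⟩
    change CovProd.dualShift χ (integratedForm β f) ∈ cstarCrossedProductSubalgebra β
    rw [integratedForm_eq_sum, map_sum]
    refine sum_mem fun s _ => ?_
    rw [CovProd.dualShift_covMonomial, ← integratedForm_single]
    exact SMulMemClass.smul_mem _ (CStarCrossedProduct.of β (Finsupp.single s (f s))).2
  exact h hx

variable (β) in
/-- The inclusion of the full crossed product into the product algebra. -/
noncomputable def CStarCrossedProduct.incl : CStarCrossedProduct β →⋆ₙₐ[ℂ] CovProd β where
  toFun x := x.1
  map_smul' _ _ := rfl
  map_zero' := rfl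
  map_add' _ _ := rfl
  map_mul' _ _ := rfl
  map_star' _ := rfl

theorem CStarCrossedProduct.incl_injective : Function.Injective (CStarCrossedProduct.incl β) :=
  Subtype.val_injective

theorem CStarCrossedProduct.incl_of (f : G →₀ C) :
    CStarCrossedProduct.incl β (CStarCrossedProduct.of β f) = integratedForm β f := rfl

/-- The dual action of a character on the full crossed product. -/
noncomputable def CStarCrossedProduct.dual (χ : G →* Circle) :
    CStarCrossedProduct β →⋆ₙₐ[ℂ] CStarCrossedProduct β where
  toFun x := ⟨CovProd.dualShift χ x.1, CovProd.dualShift_mem χ x.2⟩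
  map_smul' _ _ := rfl
  map_zero' := rfl
  map_add' _ _ := rfl
  map_mul' _ _ := rfl
  map_star' _ := rfl

theorem CStarCrossedProduct.incl_dual (χ : G →* Circle) (x : CStarCrossedProduct β) :
    CStarCrossedProduct.incl β (CStarCrossedProduct.dual χ x) =
      CovProd.dualShift χ (CStarCrossedProduct.incl β x) := rfl

variable (β) in
/-- The element `c U_s` of the full crossed product. -/
noncomputable def CStarCrossedProduct.monomial (s : G) : C →ₗ[ℂ] CStarCrossedProduct β where
  toFun c := CStarCrossedProduct.of β (Finsupp.single s c)
  map_add' c d := CStarCrossedProduct.incl_injective <| by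
    simp_rw [map_add, CStarCrossedProduct.incl_of, integratedForm_single, covMonomial_add]
  map_smul' z c := CStarCrossedProduct.incl_injective <| by
    simp_rw [map_smul, CStarCrossedProduct.incl_of, integratedForm_single, covMonomial_smul]
    rfl

theorem CStarCrossedProduct.incl_monomial (s : G) (c : C) :
    CStarCrossedProduct.incl β (CStarCrossedProduct.monomial β s c) = covMonomial β c s :=
  integratedForm_single s c

theorem CStarCrossedProduct.norm_monomial (s : G) (c : C) :
    ‖CStarCrossedProduct.monomial β s c‖ = ‖covMonomial β c s‖ :=
  by rw [← CStarCrossedProduct.incl_monomial,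
    NonUnitalStarAlgHom.norm_map _ CStarCrossedProduct.incl_injective]

theorem CStarCrossedProduct.monomial_mul (s t : G) (c d : C) :
    CStarCrossedProduct.monomial β s c * CStarCrossedProduct.monomial β t d =
      CStarCrossedProduct.monomial β (s * t) (c * β s d) :=
  CStarCrossedProduct.incl_injective <| by
    rw [map_mul]
    simp_rw [CStarCrossedProduct.incl_monomial]
    exact covMonomial_mul c d s t

theorem CStarCrossedProduct.dual_monomial (χ : G →* Circle) (s : G) (c : C) :
    CStarCrossedProduct.dual χ (CStarCrossedProduct.monomial β s c) =
      (χ s : ℂ) • CStarCrossedProduct.monomial β s c :=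
  CStarCrossedProduct.incl_injective <| by
    rw [map_smul, CStarCrossedProduct.incl_dual, CStarCrossedProduct.incl_monomial,
      CovProd.dualShift_covMonomial]

theorem CStarCrossedProduct.of_eq_sum (f : G →₀ C) :
    CStarCrossedProduct.of β f = ∑ s ∈ f.support, CStarCrossedProduct.monomial β s (f s) :=
  CStarCrossedProduct.incl_injective <| by
    rw [map_sum]
    simp_rw [CStarCrossedProduct.incl_monomial]
    rfl

theorem CStarCrossedProduct.monomial_mem {S : Set C} (h0 : 0 ∈ S) (s : G) {c : C} (hc : c ∈ S) :
    CStarCrossedProduct.monomial β s c ∈ relativeCrossedProduct β S := by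
  classical
  refine NonUnitalSubalgebra.le_topologicalClosure _ (NonUnitalAlgebra.subset_adjoin ℂ
    ⟨Finsupp.single s c, fun t => ?_, rfl⟩)
  -- The function vanishes away from `s`, which is where `0 ∈ S` enters.
  rw [Finsupp.single_apply]
  split_ifs
  exacts [hc, h0]

theorem CStarCrossedProduct.dual_mem {S : Set C} (h0 : 0 ∈ S) (χ : G →* Circle)
    {x : CStarCrossedProduct β} (hx : x ∈ relativeCrossedProduct β S) :
    CStarCrossedProduct.dual χ x ∈ relativeCrossedProduct β S := by
  have hcont : Continuous (CStarCrossedProduct.dual (β := β) χ) :=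
    AddMonoidHomClass.continuous_of_bound (CStarCrossedProduct.dual χ) 1 fun x => by
      rw [one_mul]
      exact NonUnitalStarAlgHom.norm_apply_le (CStarCrossedProduct.dual χ) x
  have h : relativeCrossedProduct β S ≤
      (relativeCrossedProduct β S).comap (CStarCrossedProduct.dual χ) := by
    refine NonUnitalSubalgebra.topologicalClosure_minimal (NonUnitalAlgebra.adjoin_le ?_)
      ((NonUnitalSubalgebra.isClosed_topologicalClosure _).preimage hcont)
    rintro _ ⟨f, hf, rfl⟩
    change CStarCrossedProduct.dual χ (CStarCrossedProduct.of β f) ∈ relativeCrossedProduct β S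
    rw [CStarCrossedProduct.of_eq_sum, map_sum]
    refine sum_mem fun s _ => ?_
    rw [CStarCrossedProduct.dual_monomial]
    exact SMulMemClass.smul_mem _ (CStarCrossedProduct.monomial_mem h0 s (hf s))
  exact h hx

/-- A relative crossed product is the closed linear span of the monomials with coefficients in a
subalgebra that is invariant under the action. -/
theorem relativeCrossedProduct_le_closure_span (S : NonUnitalSubalgebra ℂ C)
    (hS : ∀ s, ∀ c ∈ S, β s c ∈ S) :
    (relativeCrossedProduct β (S : Set C) : Set (CStarCrossedProduct β)) ⊆
      closure (⨆ s, S.toSubmodule.map (CStarCrossedProduct.monomial β s) :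
        Submodule ℂ (CStarCrossedProduct β)) := by
  let N : Submodule ℂ (CStarCrossedProduct β) :=
    ⨆ s, S.toSubmodule.map (CStarCrossedProduct.monomial β s)
  have hmem : ∀ s, ∀ c ∈ S, CStarCrossedProduct.monomial β s c ∈ N := fun s c hc =>
    Submodule.mem_iSup_of_mem s ⟨c, hc, rfl⟩
  have hmul : ∀ x ∈ N, ∀ y ∈ N, x * y ∈ N := by
    intro x hx y hy
    induction hx using Submodule.iSup_induction' with
    | zero => rw [zero_mul]; exact N.zero_mem
    | add x₁ x₂ _ _ h₁ h₂ => rw [add_mul]; exact N.add_mem h₁ h₂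
    | mem s x hx =>
      obtain ⟨c, hc, rfl⟩ := hx
      induction hy using Submodule.iSup_induction' with
      | zero => rw [mul_zero]; exact N.zero_mem
      | add y₁ y₂ _ _ h₁ h₂ => rw [mul_add]; exact N.add_mem h₁ h₂
      | mem t y hy =>
        obtain ⟨d, hd, rfl⟩ := hy
        rw [CStarCrossedProduct.monomial_mul]
        exact hmem _ _ (S.mul_mem hc (hS s d hd))
  let N' : NonUnitalSubalgebra ℂ (CStarCrossedProduct β) :=
    { N with mul_mem' := fun {x y} hx hy => hmul x hx y hy }
  refine closure_mono (show NonUnitalAlgebra.adjoin ℂ _ ≤ N' from NonUnitalAlgebra.adjoin_le ?_)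
  rintro _ ⟨f, hf, rfl⟩
  rw [CStarCrossedProduct.of_eq_sum]
  exact N.sum_mem fun s _ => hmem s _ (hf s)

end Dual

/-! ### The graded structure and the dual action on the crossed product of an operator algebra. -/

section Main

/-- A subalgebra of a normed algebra is a normed space. -/
instance subalgebraNormedSpace {E : Type*} [NonUnitalNormedRing E] [NormedSpace ℂ E]
    (S : NonUnitalSubalgebra ℂ E) : NormedSpace ℂ S where
  norm_smul_le c x := norm_smul_le c (x : E)

variable {H : Type u} [NormedAddCommGroup H] [InnerProductSpace ℂ H] [CompleteSpace H]
  {A : NonUnitalSubalgebra ℂ (H →L[ℂ] H)} {G : Type v} [Group G] (α : Action G A)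

variable (A) in
theorem CStarMax.zero_mem_range_j : (0 : CStarMax A) ∈ Set.range (CStarMax.j A) :=
  ⟨0, map_zero (CStarMax.j A)⟩

/-- Contractivity of `j` gives one inequality, the regular representation the other. -/
theorem norm_covMonomial_j (s : G) (a : A) :
    ‖covMonomial (CStarMax.action α) (CStarMax.j A a) s‖ = ‖a‖ :=
  le_antisymm ((norm_covMonomial_le _ _).trans (CStarMax.norm_j_le a))
    ((norm_le_norm_regularRep_j α a).trans (norm_le_norm_covMonomial (regularRep α) _ s))

/-- The element `a U_s` of the crossed product of an operator algebra. -/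
noncomputable def crossedProduct.monomial (s : G) : A →ₗ[ℂ] crossedProduct α :=
  LinearMap.codRestrict (crossedProduct α).toSubmodule
    (CStarCrossedProduct.monomial (CStarMax.action α) s ∘ₗ (CStarMax.j A : A →ₗ[ℂ] CStarMax A))
    fun a => CStarCrossedProduct.monomial_mem (CStarMax.zero_mem_range_j A) s ⟨a, rfl⟩

/-- The dual action of a character on the crossed product of an operator algebra. -/
noncomputable def crossedProduct.dual (χ : G →* Circle) :
    crossedProduct α →ₙₐ[ℂ] crossedProduct α where
  toFun x := ⟨CStarCrossedProduct.dual χ x.1,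
    CStarCrossedProduct.dual_mem (CStarMax.zero_mem_range_j A) χ x.2⟩
  map_smul' z x := Subtype.ext (map_smul _ z x.1)
  map_zero' := Subtype.ext (map_zero _)
  map_add' x y := Subtype.ext (map_add _ x.1 y.1)
  map_mul' x y := Subtype.ext (map_mul _ x.1 y.1)

theorem crossedProduct.norm_monomial (s : G) (a : A) :
    ‖crossedProduct.monomial α s a‖ = ‖a‖ :=
  (CStarCrossedProduct.norm_monomial s (CStarMax.j A a)).trans (norm_covMonomial_j α s a)

theorem crossedProduct.monomial_mul (s t : G) (a b : A) :
    crossedProduct.monomial α s a * crossedProduct.monomial α t b =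
      crossedProduct.monomial α (s * t) (a * α.toHom s b) :=
  Subtype.ext <| (CStarCrossedProduct.monomial_mul s t (CStarMax.j A a) (CStarMax.j A b)).trans <|
    congrArg (CStarCrossedProduct.monomial (CStarMax.action α) (s * t)) <| by
      rw [CStarMax.action_j, ← map_mul]
      rfl

theorem crossedProduct.norm_dual_le (χ : G →* Circle) (x : crossedProduct α) :
    ‖crossedProduct.dual α χ x‖ ≤ ‖x‖ :=
  NonUnitalStarAlgHom.norm_apply_le
    (CStarCrossedProduct.dual (β := CStarMax.action α) χ) x.1

theorem crossedProduct.dual_monomial (χ : G →* Circle) (s : G) (a : A) :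
    crossedProduct.dual α χ (crossedProduct.monomial α s a) =
      (χ s : ℂ) • crossedProduct.monomial α s a :=
  Subtype.ext (CStarCrossedProduct.dual_monomial χ s (CStarMax.j A a))

/-- `j(A)` is an invariant subalgebra, so the monomials span a dense subspace inside the full
crossed product; the subspace topology carries this over. -/
theorem crossedProduct.monomial_dense :
    (⨆ s, LinearMap.range (crossedProduct.monomial α s)).topologicalClosure = ⊤ := by
  refine Submodule.eq_top_iff'.2 fun x => ?_
  change x ∈ closure ((⨆ s, LinearMap.range (crossedProduct.monomial α s) :
    Submodule ℂ (crossedProduct α)) : Set (crossedProduct α))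
  rw [Topology.IsInducing.subtypeVal.closure_eq_preimage_closure_image]
  refine closure_mono ?_ (relativeCrossedProduct_le_closure_span
    (NonUnitalAlgHom.range (CStarMax.j A)) ?_ x.2)
  · change _ ≤ (⨆ s, LinearMap.range (crossedProduct.monomial α s)).map
      (crossedProduct α).toSubmodule.subtype
    refine iSup_le fun s => ?_
    rintro _ ⟨_, ⟨a, rfl⟩, rfl⟩
    exact ⟨crossedProduct.monomial α s a, Submodule.mem_iSup_of_mem s ⟨a, rfl⟩, rfl⟩
  · rintro s _ ⟨a, rfl⟩
    exact ⟨α.toHom s a, rfl⟩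

instance : CompleteSpace (crossedProduct α) :=
  (NonUnitalSubalgebra.isClosed_topologicalClosure (NonUnitalAlgebra.adjoin ℂ
    {x | ∃ f : G →₀ CStarMax A, (∀ s, f s ∈ Set.range (CStarMax.j A)) ∧
      CStarCrossedProduct.of (CStarMax.action α) f = x})).completeSpace_coe

end Main

end OpAlg

theorem mainTheorem7 {G : Type*} [CommGroup G]
    {H : Type*} [NormedAddCommGroup H] [InnerProductSpace ℂ H] [CompleteSpace H]
    (A : NonUnitalSubalgebra ℂ (H →L[ℂ] H)) (hA : IsClosed (A : Set (H →L[ℂ] H)))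
    (α : OpAlg.Action G A) (hss : OpAlg.IsSemisimple A) :
    OpAlg.IsSemisimple (OpAlg.crossedProduct α) := by
  -- For the discrete topology the Pontryagin dual consists of all characters of `G` and is compact.
  let _ : TopologicalSpace G := ⊥
  have : DiscreteTopology G := ⟨rfl⟩
  -- Closedness of `A` enters here: completeness is needed for Gelfand's formula in `A` and for
  -- closed ranges of the monomial maps.
  have : CompleteSpace A := hA.completeSpace_coe
  refine OpAlg.jacobsonRadical_eq_of_dual_action (A := A) (B := OpAlg.crossedProduct α)
    (m := OpAlg.crossedProduct.monomial α)
    (σ := fun s => α.toHom s) ?_ ?_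
    (fun s a => ⟨α.toHom s⁻¹ a, by rw [← α.map_mul, mul_inv_cancel, α.map_one]⟩)
    α.map_one ?_
    (θ := fun χ => OpAlg.crossedProduct.dual α χ.toMonoidHom)
    ?_ ?_ hss
  · exact OpAlg.crossedProduct.norm_monomial α
  · exact OpAlg.crossedProduct.monomial_mul α
  · exact OpAlg.crossedProduct.monomial_dense α
  · exact fun χ => OpAlg.crossedProduct.norm_dual_le α χ.toMonoidHom
  · exact fun χ => OpAlg.crossedProduct.dual_monomial α χ.toMonoidHom
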